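/- Let $E$ be a complex Banach space and let $A:D(A)\subseteq E\to E$ be a closed linear operator, not necessarily densely defined, which satisfies the Hille--Yosida condition: there are $\omega,C\in\mathbb R$ such that every real $\lambda>\omega$ lies in the resolvent set of $A$ and $\|(\lambda-\omega)^kR(\lambda:A)^k\|\le C$ for all $\lambda>\omega$ and all integers $k\ge1$. Equip $D(A)$ with the graph norm $\|x\|+\|Ax\|$. Let $1\le p<\infty$, $\frac1p+\frac1q=1$, $s>1$, $h>0$, $0<T<\infty$. For a Banach space $X$ let $\tilde{\mathcal D}'^s_{L^p,h}(0,T;X)$ be the space of sequences $\mathbf f=(\mathbf F_\alpha)_{\alpha\in\mathbb N}$ in $L^p(0,T;X)$ with $$\|\mathbf f\|=\Big(\sum_{\alpha=0}^\infty\frac{\alpha!^{ps}}{h^{p\alpha}}\|\mathbf F_\alpha\|_{L^p(0,T;X)}^p\Big)^{1/p}<\infty .$$ Let $W^{1,p}(0,T;E)$ be the space of functions $\mathbf F(t)=F_0+\int_0^t\mathbf F'(r)\,dr$, $t\in[0,T]$, with $F_0\in E$ and $\mathbf F'\in L^p(0,T;E)$, and let $\tilde{\mathcal D}'^s_{W^{1,p},h}(0,T;E)$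 be the space of sequences $(\mathbf F_\alpha)_\alpha$ in $W^{1,p}(0,T;E)$ with $\sum_\alpha\frac{\alpha!^{ps}}{h^{p\alpha}}\big(\|\mathbf F_\alpha\|_{L^p}^p+\|\mathbf F_\alpha'\|_{L^p}^p\big)<\infty$; for such $\mathbf f=(\mathbf F_\alpha)_\alpha$ put $\mathbf f'=(\mathbf F_\alpha')_\alpha$. A sequence $(x_\alpha)_\alpha$ in $E$ is called weighted summable if $$\sum_{\alpha=0}^\infty\frac{\alpha!^{ps}}{h^{p\alpha}}\|x_\alpha\|^p<\infty ;$$ it is then identified with the sequence of constant functions $x_\alpha$ in $\tilde{\mathcal D}'^s_{L^p,h}(0,T;E)$. Let $\mathcal D^s_{L^q,h}(0,T)$ be the space of $\varphi\in\mathcal C^\infty(0,T)$ with $\big(\sum_\alpha\frac{h^{q\alpha}}{\alpha!^{qs}}\|\varphi^{(\alpha)}\|_{L^q(0,T)}^q\big)^{1/q}<\infty$ (if $q=\infty$: $\sup_\alpha\frac{h^\alpha}{\alpha!^s}\|\varphi^{(\alpha)}\|_{L^\infty(0,T)}<\infty$), and put $\langle\mathbf f,\varphi\rangle=\sum_\alpha(-1)^\alpha\int_0^T\mathbf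 F_\alpha(t)\varphi^{(\alpha)}(t)\,dt\in E$ for $\mathbf f\in\tilde{\mathcal D}'^s_{L^p,h}(0,T;E)$ and $\varphi\in\mathcal D^s_{L^q,h}(0,T)$. Consider the Cauchy problem $\mathbf u'=A\mathbf u+\mathbf f$, $\mathbf u(0)=u_0$, with $\mathbf f=(\mathbf F_\alpha)_\alpha\in\tilde{\mathcal D}'^s_{L^p,h}(0,T;E)$ and $u_0=(u_{0,\alpha})_\alpha$ in $E$. - A *strict solution* is $\mathbf u=(\mathbf U_\alpha)_\alpha\in\tilde{\mathcal D}'^s_{W^{1,p},h}(0,T;E)\cap\tilde{\mathcal D}'^s_{L^p,h}(0,T;D(A))$ such that, for all $\alpha$, $\mathbf U_\alpha'(t)=A\mathbf U_\alpha(t)+\mathbf F_\alpha(t)$ for a.e. $t\in[0,T]$ and $\mathbf U_\alpha(0)=u_{0,\alpha}$. A *strict weak solution* is $\mathbf u$ in the same intersection with $\mathbf U_\alpha(0)=u_{0,\alpha}$ for all $\alpha$, and with $\langle\mathbf u,\varphi\rangle\in D(A)$ and $\langle\mathbf u',\varphi\rangle=A\langle\mathbf u,\varphi\rangle+\langle\mathbf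 f,\varphi\rangle$ for all $\varphi\in\mathcal D^s_{L^q,h}(0,T)$. - An *$F$-solution* is $\mathbf u\in\tilde{\mathcal D}'^s_{L^p,h}(0,T;E)$ for which there are, for $k\in\mathbb N$, $\mathbf f_k\in\tilde{\mathcal D}'^s_{L^p,h}(0,T;E)$, sequences $u_{0,k}$ in $E$, and strict solutions $\mathbf u_k$ of the problem with data $\mathbf f_k,u_{0,k}$, such that $\|\mathbf u_k-\mathbf u\|+\|\mathbf f_k-\mathbf f\|+\|u_{0,k}-u_0\|\to0$ in the norm of $\tilde{\mathcal D}'^s_{L^p,h}(0,T;E)$. An *$F$-weak solution* is defined in the same way, with strict weak solutions $\mathbf u_k$, and with the convergence replaced by $\|\langle\mathbf u_k-\mathbf u,\varphi\rangle\|+\|\langle\mathbf f_k-\mathbf f,\varphi\rangle\|+\|\langle u_{0,k}-u_0,\varphi\rangle\|\to0$ for every $\varphi\in\mathcal D^s_{L^q,h}(0,T)$. **Theorem.** (i) For every $\mathbf f\in\tilde{\mathcal D}'^s_{L^p,h}(0,T;E)$ and every weighted summable $(u_{0,\alpha})_\alpha$ with $u_{0,\alpha}\in\overline{D(A)}$ for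 all $\alpha$, the Cauchy problem has exactly one $F$-solution, and it is also an $F$-weak solution. (ii) For every $\mathbf f=(\mathbf F_\alpha)_\alpha\in\tilde{\mathcal D}'^s_{W^{1,p},h}(0,T;E)$ and every $(u_{0,\alpha})_\alpha$ with $u_{0,\alpha}\in D(A)$ and $Au_{0,\alpha}+\mathbf F_\alpha(0)\in\overline{D(A)}$ for all $\alpha$, such that $(u_{0,\alpha})_\alpha$ and $(Au_{0,\alpha})_\alpha$ are both weighted summable, the Cauchy problem has exactly one strict solution, and it is also a strict weak solution. -/

import Mathlib

open Set Filter Topology MeasureTheory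
open scoped ENNReal

noncomputable section

namespace UltraCauchy

/-! ### Closed operators: graph norm, resolvent, Hille-Yosida condition -/

section Operator

variable {E : Type*} [NormedAddCommGroup E] [NormedSpace ℂ E]

/-- The domain `D(A)` of a partially defined operator, as a space of its own; it carries the graph
norm `‖u‖ + ‖A u‖`. -/
def GraphDomain (A : E →ₗ.[ℂ] E) : Type _ := A.domain

namespace GraphDomain

variable {A : E →ₗ.[ℂ] E}

instance : AddCommGroup (GraphDomain A) := inferInstanceAs (AddCommGroup A.domain)

instance : Module ℂ (GraphDomain A) := inferInstanceAs (Module ℂ A.domain)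

/-- Forget the graph norm. -/
def toDomain (x : GraphDomain A) : A.domain := x

/-- The embedding `u ↦ (u, A u)` into `E × E` with the norm `‖x‖ + ‖y‖`. -/
def toGraph (A : E →ₗ.[ℂ] E) : GraphDomain A →ₗ[ℂ] WithLp 1 (E × E) where
  toFun x := WithLp.toLp 1 ((x.toDomain : E), A x.toDomain)
  map_add' x y := by
    have h : (x + y).toDomain = x.toDomain + y.toDomain := rfl
    rw [h, A.map_add]
    rfl
  map_smul' c x := by
    have h : (c • x).toDomain = c • x.toDomain := rfl
    rw [h, A.map_smul]
    rfl

theorem toGraph_injective (A : E →ₗ.[ℂ] E) : Function.Injective (toGraph A) := by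
  intro x y h
  have h1 : (x.toDomain : E) = y.toDomain := congrArg (fun z => (WithLp.ofLp z).1) h
  exact Subtype.ext h1

instance : NormedAddCommGroup (GraphDomain A) :=
  NormedAddCommGroup.induced _ _ (toGraph A) (toGraph_injective A)

instance : NormedSpace ℂ (GraphDomain A) :=
  NormedSpace.induced ℂ _ _ (toGraph A)

theorem norm_eq (x : GraphDomain A) : ‖x‖ = ‖(x.toDomain : E)‖ + ‖A x.toDomain‖ := by
  change ‖toGraph A x‖ = _
  rw [WithLp.prod_norm_eq_of_L1]
  rfl

end GraphDomain

/-- `R` is the resolvent `R(z : A)`, the bounded everywhere defined two-sided inverse of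
`z - A : D(A) → E`. -/
def IsResolventAt (A : E →ₗ.[ℂ] E) (z : ℂ) (R : E →L[ℂ] E) : Prop :=
  (∀ x : E, ∃ hx : R x ∈ A.domain, z • R x - A ⟨R x, hx⟩ = x) ∧
    ∀ x : A.domain, R (z • (x : E) - A x) = x

/-- The Hille-Yosida condition with constants `ω` and `C`: every real `r > ω` lies in the resolvent
set of `A`, and `‖(r - ω) ^ k R(r : A) ^ k‖ ≤ C` for every integer `k ≥ 1`. -/
def HilleYosida (A : E →ₗ.[ℂ] E) (ω C : ℝ) : Prop :=
  ∀ r : ℝ, ω < r → ∃ R : E →L[ℂ] E, IsResolventAt A (r : ℂ) R ∧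
    ∀ k : ℕ, 1 ≤ k → ‖((r - ω : ℝ) : ℂ) ^ k • R ^ k‖ ≤ C

end Operator

/-! ### Function and sequence spaces -/

/-- Lebesgue measure on the interval `(0, T)`. -/
def intervalMeasure (T : ℝ) : Measure ℝ := volume.restrict (Ioo 0 T)

/-- The Bochner space `L^p(0, T; X)`. -/
abbrev LpI (X : Type*) [NormedAddCommGroup X] (p : ℝ≥0∞) (T : ℝ) : Type _ :=
  Lp X p (intervalMeasure T)

/-- The vector valued Sobolev space `W^{1,p}(0, T; E)`: its elements are the functions
`F(t) = F₀ + ∫_0^t F'(r) dr` on `[0, T]`, with `F₀ ∈ E` and `F' ∈ L^p(0, T; E)`. The function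
determines `F₀` and `F'`, see `W1p.ext_of_eqOn`. -/
structure W1p (E : Type*) [NormedAddCommGroup E] (p : ℝ≥0∞) (T : ℝ) where
  /-- the value at `0` -/
  init : E
  /-- the derivative -/
  der : LpI E p T

section Spaces

variable {X : Type*} [NormedAddCommGroup X]

/-- The weight `α!^{ps} / h^{pα}`. -/
def weight (p : ℝ≥0∞) (s h : ℝ) (α : ℕ) : ℝ :=
  (Nat.factorial α : ℝ) ^ (p.toReal * s) / h ^ (p.toReal * α)

/-- The norm `(∑_α α!^{ps} / h^{pα} ‖F_α‖_{L^p(0,T;X)}^p)^{1/p}`, with values in `[0, ∞]`, of a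
sequence of functions. -/
def seqNorm (p : ℝ≥0∞) (s h T : ℝ) (F : ℕ → ℝ → X) : ℝ≥0∞ :=
  (∑' α, ENNReal.ofReal (weight p s h α) *
    eLpNorm (F α) p (intervalMeasure T) ^ p.toReal) ^ (1 / p.toReal)

/-- The space `\tilde D'^s_{L^p,h}(0, T; X)`. -/
def SeqLp (X : Type*) [NormedAddCommGroup X] (p : ℝ≥0∞) (s h T : ℝ) : Set (ℕ → LpI X p T) :=
  {F | seqNorm p s h T (fun α => F α) < ∞}

/-- Weighted summability of a sequence of vectors:
`∑_α α!^{ps} / h^{pα} ‖x_α‖^p < ∞`. -/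
def WeightedSummable (p : ℝ≥0∞) (s h : ℝ) (x : ℕ → X) : Prop :=
  Summable fun α => weight p s h α * ‖x α‖ ^ p.toReal

end Spaces

section Sobolev

variable {E : Type*} [NormedAddCommGroup E] [NormedSpace ℂ E]

/-- The function `F(t) = F₀ + ∫_0^t F'(r) dr`, meant for `t ∈ [0, T]`. -/
def W1p.toFun {p : ℝ≥0∞} {T : ℝ} (F : W1p E p T) (t : ℝ) : E :=
  F.init + ∫ r in (0 : ℝ)..t, F.der r

instance (p : ℝ≥0∞) (T : ℝ) : CoeFun (W1p E p T) (fun _ => ℝ → E) where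
  coe F := F.toFun

theorem W1p.ext_of_eqOn [CompleteSpace E] {p : ℝ≥0∞} (hp : 1 ≤ p) {T : ℝ} (hT : 0 < T)
    {F G : W1p E p T} (h : EqOn F G (Icc 0 T)) : F = G := by
  have h0 : F.init = G.init := by simpa [W1p.toFun] using h (left_mem_Icc.2 hT.le)
  have hi : ∀ K : LpI E p T, IntegrableOn K (Ioo 0 T) := fun K =>
    haveI : IsFiniteMeasure (intervalMeasure T) := by unfold intervalMeasure; infer_instance
    (Lp.memLp K).integrable hp
  have hd : F.der =ᵐ[intervalMeasure T] G.der := by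
    have hv : ∀ K : LpI E p T, IntervalIntegrable K volume 0 T := fun K =>
      (intervalIntegrable_iff_integrableOn_Ioo_of_le hT.le).2 (hi K)
    have hz : (0 : ℝ) ∈ uIcc 0 T := left_mem_uIcc
    have h1 := (hv F.der).ae_hasDerivAt_integral
    have h2 := (hv G.der).ae_hasDerivAt_integral
    unfold intervalMeasure
    refine (ae_restrict_iff' measurableSet_Ioo).2 ?_
    filter_upwards [h1, h2] with t ht1 ht2 ht
    have htm : t ∈ uIcc 0 T := by rw [uIcc_of_le hT.le]; exact Ioo_subset_Icc_self ht
    refine (ht1 htm 0 hz).unique ((ht2 htm 0 hz).congr_of_eventuallyEq ?_)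
    filter_upwards [Ioo_mem_nhds ht.1 ht.2] with r hr
    have h3 : F.init + ∫ x in (0 : ℝ)..r, F.der x = G.init + ∫ x in (0 : ℝ)..r, G.der x :=
      h (Ioo_subset_Icc_self hr)
    rw [h0] at h3
    exact add_left_cancel h3
  cases F; cases G
  obtain rfl : _ = _ := h0
  obtain rfl := Lp.ext hd
  rfl

/-- The norm `(∑_α α!^{ps} / h^{pα} (‖F_α‖_{L^p}^p + ‖F_α'‖_{L^p}^p))^{1/p}`, with values in
`[0, ∞]`. -/
def seqSobolevNorm (p : ℝ≥0∞) (s h T : ℝ) (F : ℕ → W1p E p T) : ℝ≥0∞ :=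
  (∑' α, ENNReal.ofReal (weight p s h α) *
    (eLpNorm (F α) p (intervalMeasure T) ^ p.toReal +
      eLpNorm (F α).der p (intervalMeasure T) ^ p.toReal)) ^ (1 / p.toReal)

/-- The space `\tilde D'^s_{W^{1,p},h}(0, T; E)`. -/
def SeqW1p (E : Type*) [NormedAddCommGroup E] [NormedSpace ℂ E] (p : ℝ≥0∞) (s h T : ℝ) :
    Set (ℕ → W1p E p T) :=
  {F | seqSobolevNorm p s h T F < ∞}

/-- The space `\tilde D'^s_{W^{1,p},h}(0, T; E) ∩ \tilde D'^s_{L^p,h}(0, T; D(A))`. -/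
def SeqW1pDom (A : E →ₗ.[ℂ] E) (p : ℝ≥0∞) (s h T : ℝ) : Set (ℕ → W1p E p T) :=
  {U | U ∈ SeqW1p E p s h T ∧ ∃ V ∈ SeqLp (GraphDomain A) p s h T,
    ∀ α, ∀ᵐ t ∂intervalMeasure T, ((V α t).toDomain : E) = U α t}

/-! ### Test functions and the pairing -/

/-- The norm of `D^s_{L^q,h}(0, T)`, with values in `[0, ∞]`:
`(∑_α h^{qα} / α!^{qs} ‖φ^{(α)}‖_{L^q}^q)^{1/q}` for `q < ∞`, and
`sup_α h^α / α!^s ‖φ^{(α)}‖_{L^∞}` for `q = ∞`. -/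
def testNorm (q : ℝ≥0∞) (s h T : ℝ) (φ : ℝ → ℂ) : ℝ≥0∞ :=
  if q = ∞ then
    ⨆ α : ℕ, ENNReal.ofReal (h ^ α / (Nat.factorial α : ℝ) ^ s) *
      eLpNorm (iteratedDeriv α φ) ∞ (intervalMeasure T)
  else
    (∑' α : ℕ, ENNReal.ofReal (h ^ (q.toReal * α) / (Nat.factorial α : ℝ) ^ (q.toReal * s)) *
      eLpNorm (iteratedDeriv α φ) q (intervalMeasure T) ^ q.toReal) ^ (1 / q.toReal)

/-- The test space `D^s_{L^q,h}(0, T)`. Only the values of `φ` on the open interval matter. -/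
def TestSpace (q : ℝ≥0∞) (s h T : ℝ) : Set (ℝ → ℂ) :=
  {φ | ContDiffOn ℝ ((⊤ : ℕ∞) : WithTop ℕ∞) φ (Ioo 0 T) ∧ testNorm q s h T φ < ∞}

/-- The pairing `⟨f, φ⟩ = ∑_α (-1)^α ∫_0^T F_α(t) φ^{(α)}(t) dt ∈ E`. -/
def pairing (T : ℝ) (F : ℕ → ℝ → E) (φ : ℝ → ℂ) : E :=
  ∑' α : ℕ, (-1 : ℂ) ^ α • ∫ t, iteratedDeriv α φ t • F α t ∂intervalMeasure T

/-! ### Solutions of `u' = A u + f`, `u(0) = u₀` -/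

/-- Strict solutions. -/
def IsStrictSolution (A : E →ₗ.[ℂ] E) (p : ℝ≥0∞) (s h T : ℝ) (f : ℕ → ℝ → E) (u₀ : ℕ → E)
    (u : ℕ → W1p E p T) : Prop :=
  u ∈ SeqW1pDom A p s h T ∧
    (∀ α, ∀ᵐ t ∂intervalMeasure T,
      ∃ ht : u α t ∈ A.domain, (u α).der t = A ⟨u α t, ht⟩ + f α t) ∧
    ∀ α, u α 0 = u₀ α

/-- Strict weak solutions; `q` is the exponent of the test functions. -/
def IsStrictWeakSolution (A : E →ₗ.[ℂ] E) (p q : ℝ≥0∞) (s h T : ℝ) (f : ℕ → ℝ → E) (u₀ : ℕ → E)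
    (u : ℕ → W1p E p T) : Prop :=
  u ∈ SeqW1pDom A p s h T ∧
    (∀ φ ∈ TestSpace q s h T, ∃ hφ : pairing T (fun α => u α) φ ∈ A.domain,
      pairing T (fun α => (u α).der) φ = A ⟨pairing T (fun α => u α) φ, hφ⟩ + pairing T f φ) ∧
    ∀ α, u α 0 = u₀ α

/-- `F`-solutions: limits of strict solutions, with convergence of the data, in the norm of
`\tilde D'^s_{L^p,h}(0, T; E)`. -/
def IsFSolution (A : E →ₗ.[ℂ] E) (p : ℝ≥0∞) (s h T : ℝ) (f : ℕ → ℝ → E) (u₀ : ℕ → E)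
    (u : ℕ → LpI E p T) : Prop :=
  u ∈ SeqLp E p s h T ∧
    ∃ (uk : ℕ → ℕ → W1p E p T) (fk : ℕ → ℕ → LpI E p T) (u₀k : ℕ → ℕ → E),
      (∀ k, fk k ∈ SeqLp E p s h T ∧
        IsStrictSolution A p s h T (fun α => fk k α) (u₀k k) (uk k)) ∧
      Tendsto (fun k =>
          seqNorm p s h T (fun α t => uk k α t - u α t) +
          seqNorm p s h T (fun α t => fk k α t - f α t) +
          seqNorm p s h T (fun α _ => u₀k k α - u₀ α)) atTop (𝓝 0)

/-- `F`-weak solutions: limits of strict weak solutions, with convergence of the data, after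
pairing with each test function. -/
def IsFWeakSolution (A : E →ₗ.[ℂ] E) (p q : ℝ≥0∞) (s h T : ℝ) (f : ℕ → ℝ → E) (u₀ : ℕ → E)
    (u : ℕ → LpI E p T) : Prop :=
  u ∈ SeqLp E p s h T ∧
    ∃ (uk : ℕ → ℕ → W1p E p T) (fk : ℕ → ℕ → LpI E p T) (u₀k : ℕ → ℕ → E),
      (∀ k, fk k ∈ SeqLp E p s h T ∧
        IsStrictWeakSolution A p q s h T (fun α => fk k α) (u₀k k) (uk k)) ∧
      ∀ φ ∈ TestSpace q s h T, Tendsto (fun k =>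
          ‖pairing T (fun α t => uk k α t - u α t) φ‖ +
          ‖pairing T (fun α t => fk k α t - f α t) φ‖ +
          ‖pairing T (fun α _ => u₀k k α - u₀ α) φ‖) atTop (𝓝 0)

end Sobolev

end UltraCauchy

end

/-! The problem decouples: every component `U_α` solves a Cauchy problem for the same operator `A`
on `E`. Hence it suffices to solve the problem in `W^{1,p}(0, T; E)` with constants depending only
on `A`, `p`, `T`; the weighted sums over `α` then follow from the componentwise bounds.

For one component, `A` is replaced by its bounded Yosida approximations `B_n`, whose semigroups
`S_n` are bounded uniformly in `n` on `[0, T]`. Without density of `D(A)`, convergence of `S_n(t) x`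
is available only for `x` in the closure of `D(A)`. The decisive fact is `cauchySeq_duhamel`: the
convolutions of `S_n` with any integrable `g` converge, even if `g` leaves that closure. For data
`u₀`, `f = f₀ + ∫ g`, the limit `v` of `S_n(t)(A u₀ + f₀) + (S_n * g)(t)` is the derivative of the
strict solution, because `A` is closed (`exists_strict`). The compatibility condition says that
`v(0) = A u₀ + f₀` lies where the `S_n` converge.

Uniqueness and stability come from the a priori bound `norm_strict_le` of a strict solution by its
initial value and the `L^1` norm of the source. Data admitting strict solutions are dense
(`exists_solvesAE_approx`), so the bound yields limit solutions of each component. An `F`-solution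
is assembled from them by truncation: the `k`-th approximant uses finitely many components and is
zero beyond, so no rate of convergence in `α` is needed.

For the weak notions, Hölder's inequality (`tsum_mul_le`) makes the pairing continuous, and the
equation is rewritten as `R(z u - (u' - f)) = u` with a bounded resolvent `R`, which commutes with
integrals and series. -/

set_option linter.unusedSectionVars false

noncomputable section

namespace UltraCauchy

/-! ### Resolvents and bounds on the Yosida approximations. -/

section Resolvent

variable {E : Type*} [NormedAddCommGroup E] [NormedSpace ℂ E] {A : E →ₗ.[ℂ] E}

theorem IsResolventAt.apply_graph {z : ℂ} {R : E →L[ℂ] E} (h : IsResolventAt A z R) {x y : E}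
    (hxy : (x, y) ∈ A.graph) : R (z • x - y) = x := by
  obtain ⟨w, rfl, rfl⟩ := (LinearPMap.mem_graph_iff A).1 hxy
  exact h.2 w

theorem IsResolventAt.mem_graph {z : ℂ} {R : E →L[ℂ] E} (h : IsResolventAt A z R) (x : E) :
    (R x, z • R x - x) ∈ A.graph := by
  obtain ⟨hx, e⟩ := h.1 x
  refine (LinearPMap.mem_graph_iff A).2 ⟨⟨R x, hx⟩, rfl, ?_⟩
  change A ⟨R x, hx⟩ = z • R x - x
  exact (sub_eq_of_eq_add (sub_eq_iff_eq_add'.1 e)).symm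

/-- This turns a statement about the unbounded operator into an equation for a bounded one, which
can be passed through integrals and sums. -/
theorem IsResolventAt.mem_graph_iff {z : ℂ} {R : E →L[ℂ] E} (h : IsResolventAt A z R) {x y : E} :
    (x, y) ∈ A.graph ↔ R (z • x - y) = x := by
  refine ⟨h.apply_graph, fun e => ?_⟩
  have := h.mem_graph (z • x - y)
  rwa [e, sub_sub_cancel] at this

/-- The resolvent identity. -/
theorem IsResolventAt.sub_eq {z w : ℂ} {R S : E →L[ℂ] E} (hR : IsResolventAt A z R)
    (hS : IsResolventAt A w S) (x : E) : S x - R x = (z - w) • R (S x) := by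
  have h1 := hR.apply_graph (hS.mem_graph x)
  have h2 : z • S x - (w • S x - x) = x + (z - w) • S x := by rw [sub_smul]; abel
  rw [h2, map_add, map_smul] at h1
  rw [eq_comm, ← sub_eq_iff_eq_add'.2 h1.symm]

theorem IsResolventAt.commute {z w : ℂ} {R S : E →L[ℂ] E} (hR : IsResolventAt A z R)
    (hS : IsResolventAt A w S) : Commute R S := by
  ext x
  change R (S x) = S (R x)
  rcases eq_or_ne z w with rfl | hzw
  · have h : ∀ y, S y = R y := fun y => by simpa [sub_eq_zero] using hR.sub_eq hS y
    rw [h, h]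
  · have h1 := hR.sub_eq hS x
    have h2 := hS.sub_eq hR x
    have h3 : (z - w) • R (S x) = (z - w) • S (R x) := by
      rw [← h1, ← neg_sub, h2, ← neg_smul, neg_sub]
    exact smul_right_injective E (sub_ne_zero.2 hzw) h3

/-- The exponential series is bounded term by term. Control of all powers keeps `C` outside the
exponent; a bound on `‖R‖` alone would put it inside. The condition `1 ≤ C` takes care of the power
zero. -/
theorem norm_exp_smul_le {R : E →L[ℂ] E} [CompleteSpace E] {a ρ C : ℝ} (ha : 0 ≤ a)
    (hC : 1 ≤ C) (hR : ∀ k : ℕ, 1 ≤ k → ‖R ^ k‖ ≤ C * ρ ^ k) :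
    ‖NormedSpace.exp (a • R)‖ ≤ C * Real.exp (a * ρ) := by
  have hk : ∀ k : ℕ, ‖R ^ k‖ ≤ C * ρ ^ k := by
    intro k
    rcases Nat.eq_zero_or_pos k with rfl | hk
    · simpa [ContinuousLinearMap.one_def] using
        (ContinuousLinearMap.norm_id_le (𝕜 := ℂ) (E := E)).trans hC
    · exact hR k hk
  have hs : HasSum (fun n : ℕ => C * ((a * ρ) ^ n / n.factorial)) (C * Real.exp (a * ρ)) := by
    rw [Real.exp_eq_exp_ℝ]
    exact (NormedSpace.expSeries_div_hasSum_exp (a * ρ)).mul_left C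
  rw [NormedSpace.exp_eq_tsum ℝ]
  refine tsum_of_norm_bounded hs fun n => ?_
  rw [smul_pow, norm_smul, norm_smul, norm_pow, norm_inv, Real.norm_of_nonneg ha]
  simp only [RCLike.norm_natCast]
  calc _ ≤ (n.factorial : ℝ)⁻¹ * (a ^ n * (C * ρ ^ n)) := by gcongr; exact hk n
    _ = _ := by rw [mul_pow]; ring

/-- Resolvents along a sequence of reals tending to infinity, together with the bounds on the
Yosida approximations that follow from the Hille-Yosida condition. -/
structure YosidaSystem (A : E →ₗ.[ℂ] E) (T M : ℝ) where
  /-- the points of the resolvent set -/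
  lam : ℕ → ℝ
  /-- the resolvents -/
  R : ℕ → E →L[ℂ] E
  lam_pos : ∀ n, 0 < lam n
  lam_tendsto : Tendsto lam atTop atTop
  isResolventAt : ∀ n, IsResolventAt A (lam n : ℂ) (R n)
  one_le : 1 ≤ M
  norm_smul_R_le : ∀ n, lam n * ‖R n‖ ≤ M
  norm_exp_le : ∀ n, ∀ t ∈ Icc 0 T,
    ‖NormedSpace.exp (t • (lam n • (lam n • R n - 1)))‖ ≤ M

theorem exp_smul_sub_one [CompleteSpace E] (t l : ℝ) (R : E →L[ℂ] E) :
    NormedSpace.exp (t • (l • (l • R - 1))) =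
      Real.exp (-(t * l)) • NormedSpace.exp ((t * l * l) • R) := by
  have h : t • (l • (l • R - 1)) = algebraMap ℝ (E →L[ℂ] E) (-(t * l)) + (t * l * l) • R := by
    rw [Algebra.algebraMap_eq_smul_one]; module
  let _ : NormedAlgebra ℚ (E →L[ℂ] E) := NormedAlgebra.restrictScalars ℚ ℝ _
  rw [h, NormedSpace.exp_add_of_commute (Algebra.commutes _ _), ← NormedSpace.algebraMap_exp_comm,
    ← Real.exp_eq_exp_ℝ, Algebra.algebraMap_eq_smul_one, smul_mul_assoc, one_mul]

theorem HilleYosida.exists_yosidaSystem [CompleteSpace E] {ω C : ℝ} (h : HilleYosida A ω C)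
    (T : ℝ) : ∃ M, Nonempty (YosidaSystem A T M) := by
  choose! Res hRes hpow using h
  set C' := max 1 C with hC'
  -- The shift forces `lam n - ω ≥ lam n / 2`, so that `lam n / (lam n - ω) ≤ 2` for every `n`.
  set lam : ℕ → ℝ := fun n => n + (2 * |ω| + 1) with hlam
  have hl0 : ∀ n, 2 * |ω| + 1 ≤ lam n := fun n => by simp [hlam]
  have hlω : ∀ n, ω < lam n := fun n => by
    have := hl0 n; have := le_abs_self ω; have := abs_nonneg ω; linarith
  have hlpos : ∀ n, 0 < lam n := fun n => by have := hl0 n; have := abs_nonneg ω; linarith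
  have hhalf : ∀ n, lam n / 2 ≤ lam n - ω := fun n => by
    have := hl0 n; have := le_abs_self ω; linarith
  have hpow' : ∀ n k, 1 ≤ k → ‖Res (lam n) ^ k‖ ≤ C' * ((lam n - ω)⁻¹) ^ k := by
    intro n k hk
    have h1 := hpow (lam n) (hlω n) k hk
    have h2 : 0 < lam n - ω := sub_pos.2 (hlω n)
    rw [norm_smul, norm_pow, Complex.norm_real, Real.norm_of_nonneg h2.le] at h1
    rw [inv_pow, ← div_eq_mul_inv, le_div_iff₀ (by positivity), mul_comm]
    exact h1.trans (le_max_right _ _)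
  -- The first entry bounds `λ R(λ : A)`, the second the approximating semigroups on `[0, T]`.
  refine ⟨max (2 * C') (C' * Real.exp (T * (2 * |ω|))), ⟨
    { lam := lam, R := fun n => Res (lam n), lam_pos := hlpos, lam_tendsto := ?_
      isResolventAt := fun n => hRes _ (hlω n), one_le := ?_, norm_smul_R_le := fun n => ?_
      norm_exp_le := fun n t ht => ?_ }⟩⟩
  · exact tendsto_atTop_add_const_right _ _ tendsto_natCast_atTop_atTop
  · exact le_max_of_le_left (by have := le_max_left 1 C; linarith)
  · refine le_max_of_le_left ?_
    have h1 := hpow' n 1 le_rfl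
    have h2 : 0 < lam n - ω := sub_pos.2 (hlω n)
    rw [pow_one, pow_one, ← div_eq_mul_inv, le_div_iff₀ h2] at h1
    nlinarith [hhalf n, norm_nonneg (Res (lam n))]
  · refine le_max_of_le_right ?_
    have h2 : 0 < lam n - ω := sub_pos.2 (hlω n)
    rw [exp_smul_sub_one, norm_smul, Real.norm_of_nonneg (Real.exp_pos _).le]
    have h3 := norm_exp_smul_le (a := t * lam n * lam n) (ρ := (lam n - ω)⁻¹)
      (by have := ht.1; have := hlpos n; positivity) (le_max_left 1 C) (hpow' n)
    -- The growing parts of the two exponents cancel and leave `t λ ω / (λ - ω)`, which is bounded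
    -- uniformly in `λ`.
    have h4 : -(t * lam n) + t * lam n * lam n * (lam n - ω)⁻¹ ≤ T * (2 * |ω|) := by
      have : -(t * lam n) + t * lam n * lam n * (lam n - ω)⁻¹ =
          t * (lam n * (lam n - ω)⁻¹ * ω) := by field_simp; ring
      rw [this]
      have h5 : lam n * (lam n - ω)⁻¹ ≤ 2 := by
        rw [← div_eq_mul_inv, div_le_iff₀ h2]; linarith [hhalf n]
      have h6 : 0 ≤ lam n * (lam n - ω)⁻¹ := by have := hlpos n; positivity
      have h7 : lam n * (lam n - ω)⁻¹ * ω ≤ 2 * |ω| :=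
        (mul_le_mul_of_nonneg_left (le_abs_self ω) h6).trans
          (mul_le_mul_of_nonneg_right h5 (abs_nonneg ω))
      calc _ ≤ t * (2 * |ω|) := mul_le_mul_of_nonneg_left h7 ht.1
        _ ≤ _ := mul_le_mul_of_nonneg_right ht.2 (by positivity)
    calc _ ≤ Real.exp (-(t * lam n)) * (C' * Real.exp (t * lam n * lam n * (lam n - ω)⁻¹)) := by
          gcongr
      _ = C' * Real.exp (-(t * lam n) + t * lam n * lam n * (lam n - ω)⁻¹) := by
          rw [Real.exp_add]; ring
      _ ≤ _ := by gcongr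

/-! ### Algebra of the Yosida approximations. -/

namespace YosidaSystem

variable {T M : ℝ} (Y : YosidaSystem A T M)

/-- The operators `λ R(λ : A)`. -/
def J (n : ℕ) : E →L[ℂ] E := Y.lam n • Y.R n

/-- The Yosida approximations `λ (λ R(λ : A) - 1)`. -/
def B (n : ℕ) : E →L[ℂ] E := Y.lam n • (Y.J n - 1)

/-- The semigroups generated by the Yosida approximations. -/
def S (n : ℕ) (t : ℝ) : E →L[ℂ] E := NormedSpace.exp (t • Y.B n)

theorem J_apply (n : ℕ) (x : E) : Y.J n x = Y.lam n • Y.R n x := rfl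

theorem B_apply (n : ℕ) (x : E) : Y.B n x = Y.lam n • (Y.J n x - x) := rfl

theorem nonneg (Y : YosidaSystem A T M) : 0 ≤ M := zero_le_one.trans Y.one_le

theorem norm_J_le (n : ℕ) : ‖Y.J n‖ ≤ M := by
  rw [J, norm_smul, Real.norm_of_nonneg (Y.lam_pos n).le]
  exact Y.norm_smul_R_le n

theorem norm_J_apply_le (n : ℕ) (x : E) : ‖Y.J n x‖ ≤ M * ‖x‖ :=
  (Y.J n).le_of_opNorm_le (Y.norm_J_le n) x

theorem norm_S_apply_le (n : ℕ) {t : ℝ} (ht : t ∈ Icc 0 T) (x : E) : ‖Y.S n t x‖ ≤ M * ‖x‖ :=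
  (Y.S n t).le_of_opNorm_le (Y.norm_exp_le n t ht) x

theorem mem_graph_iff (n : ℕ) {x y : E} :
    (x, y) ∈ A.graph ↔ Y.R n (Y.lam n • x - y) = x := by
  rw [(Y.isResolventAt n).mem_graph_iff, Complex.coe_smul]

theorem R_mem_graph (n : ℕ) (x : E) : (Y.R n x, Y.J n x - x) ∈ A.graph := by
  have h := (Y.isResolventAt n).mem_graph x
  rwa [Complex.coe_smul] at h

theorem J_mem_graph (n : ℕ) (x : E) : (Y.J n x, Y.B n x) ∈ A.graph := by
  have h := A.graph.smul_mem (Y.lam n : ℂ) (Y.R_mem_graph n x)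
  rwa [Complex.coe_smul] at h

/-- The resolvent commutes with `A` on the domain. Consequently `B n x` converges as soon as `A x`
lies in the closure of `D(A)`. -/
theorem B_apply_of_mem_graph (n : ℕ) {x y : E} (h : (x, y) ∈ A.graph) : Y.B n x = Y.J n y := by
  have h1 := (Y.mem_graph_iff n).1 h
  rw [map_sub, ContinuousLinearMap.map_smul_of_tower] at h1
  have h2 : Y.J n x - x = Y.R n y := by
    rw [J_apply, sub_eq_iff_eq_add, ← sub_eq_iff_eq_add']; exact h1
  rw [B_apply, h2, J_apply]

theorem J_sub_of_mem_graph (n : ℕ) {x y : E} (h : (x, y) ∈ A.graph) :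
    Y.J n x - x = Y.R n y := by
  have h1 := (Y.mem_graph_iff n).1 h
  rw [map_sub, ContinuousLinearMap.map_smul_of_tower] at h1
  rw [J_apply, sub_eq_iff_eq_add, ← sub_eq_iff_eq_add']; exact h1

theorem J_mem_domain (n : ℕ) (x : E) : Y.J n x ∈ A.domain :=
  LinearPMap.mem_domain_of_mem_graph (Y.J_mem_graph n x)

theorem R_mem_domain (n : ℕ) (x : E) : Y.R n x ∈ A.domain :=
  LinearPMap.mem_domain_of_mem_graph (Y.R_mem_graph n x)

theorem tendsto_inv_lam : Tendsto (fun n => (Y.lam n)⁻¹) atTop (𝓝 0) :=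
  tendsto_inv_atTop_zero.comp Y.lam_tendsto

theorem norm_R_apply_le (n : ℕ) (x : E) : ‖Y.R n x‖ ≤ (Y.lam n)⁻¹ * (M * ‖x‖) := by
  have h := Y.norm_J_apply_le n x
  rw [J_apply, norm_smul, Real.norm_of_nonneg (Y.lam_pos n).le] at h
  rwa [inv_mul_eq_div, le_div_iff₀' (Y.lam_pos n)]

theorem tendsto_R_apply (x : E) : Tendsto (fun n => Y.R n x) atTop (𝓝 0) := by
  refine squeeze_zero_norm (fun n => Y.norm_R_apply_le n x) ?_
  simpa using Y.tendsto_inv_lam.mul_const (M * ‖x‖)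

theorem commute_R (m n : ℕ) : Commute (Y.R m) (Y.R n) :=
  (Y.isResolventAt m).commute (Y.isResolventAt n)

theorem commute_R_J (m n : ℕ) : Commute (Y.R m) (Y.J n) := (Y.commute_R m n).smul_right _

theorem commute_R_B (m n : ℕ) : Commute (Y.R m) (Y.B n) :=
  ((Y.commute_R_J m n).sub_right (Commute.one_right _)).smul_right _

theorem commute_B (m n : ℕ) : Commute (Y.B m) (Y.B n) :=
  (((Y.commute_R_B m n).smul_left (Y.lam m)).sub_left (Commute.one_left _)).smul_left _

theorem commute_R_S [CompleteSpace E] (m n : ℕ) (t : ℝ) : Commute (Y.R m) (Y.S n t) := by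
  let _ : NormedAlgebra ℚ (E →L[ℂ] E) := NormedAlgebra.restrictScalars ℚ ℝ _
  exact ((Y.commute_R_B m n).smul_right t).exp_right

theorem commute_B_S [CompleteSpace E] (m n : ℕ) (t : ℝ) : Commute (Y.B m) (Y.S n t) := by
  let _ : NormedAlgebra ℚ (E →L[ℂ] E) := NormedAlgebra.restrictScalars ℚ ℝ _
  exact ((Y.commute_B m n).smul_right t).exp_right

end YosidaSystem

/-- The operators are complex linear while the variable is real, so the product rule is applied
after restricting scalars. -/
theorem hasDerivAt_complex_clm_apply {L : ℝ → E →L[ℂ] E} {L' : E →L[ℂ] E} {f : ℝ → E} {f' : E}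
    {t : ℝ} (hL : HasDerivAt L L' t) (hf : HasDerivAt f f' t) :
    HasDerivAt (fun r => L r (f r)) (L' (f t) + L t f') t :=
  ((ContinuousLinearMap.restrictScalarsL ℂ E E ℝ ℝ).hasFDerivAt.comp_hasDerivAt t hL).clm_apply hf

/-- A sequence that is uniformly approximated by Cauchy sequences is Cauchy. -/
theorem cauchySeq_of_forall_approx {F : Type*} [PseudoMetricSpace F] {a : ℕ → F}
    (h : ∀ ε > 0, ∃ b : ℕ → F, CauchySeq b ∧ ∀ n, dist (a n) (b n) ≤ ε) : CauchySeq a := by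
  refine Metric.cauchySeq_iff'.2 fun ε hε => ?_
  obtain ⟨b, hb, hab⟩ := h (ε / 4) (by positivity)
  obtain ⟨N, hN⟩ := Metric.cauchySeq_iff'.1 hb (ε / 4) (by positivity)
  refine ⟨N, fun n hn => ?_⟩
  have h1 := dist_triangle4 (a n) (b n) (b N) (a N)
  have h2 := hab N
  rw [dist_comm] at h2
  linarith [hab n, hN n hn]

/-- A pointwise bounded sequence of operators that is Cauchy on a set is Cauchy on its closure. -/
theorem cauchySeq_apply_of_mem_closure {L : ℕ → E →L[ℂ] E} {M : ℝ} (hM : 0 ≤ M)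
    (hL : ∀ n x, ‖L n x‖ ≤ M * ‖x‖) {s : Set E} (hs : ∀ x ∈ s, CauchySeq fun n => L n x) {x : E}
    (hx : x ∈ closure s) : CauchySeq fun n => L n x := by
  refine cauchySeq_of_forall_approx fun ε hε => ?_
  obtain ⟨y, hy, hxy⟩ := Metric.mem_closure_iff.1 hx (ε / (M + 1)) (by positivity)
  refine ⟨_, hs y hy, fun n => ?_⟩
  rw [dist_eq_norm, ← map_sub]
  rw [dist_eq_norm, lt_div_iff₀ (by positivity)] at hxy
  nlinarith [hL n (x - y), norm_nonneg (x - y)]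

namespace YosidaSystem

variable {T M : ℝ} (Y : YosidaSystem A T M)

/-- On `D(A)` the error is `R n (A x)`, of order `1 / lam n`; the uniform bound on `J n` carries the
limit to the closure. It cannot hold further out, since `J n` takes values in `D(A)`. -/
theorem tendsto_J_apply {x : E} (hx : x ∈ closure (A.domain : Set E)) :
    Tendsto (fun n => Y.J n x) atTop (𝓝 x) := by
  have key : ∀ y ∈ (A.domain : Set E), Tendsto (fun n => Y.J n y) atTop (𝓝 y) := fun y hy => by
    obtain ⟨z, hz⟩ := LinearPMap.mem_domain_iff.1 hy
    have h := (Y.tendsto_R_apply z).add_const y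
    simpa only [← Y.J_sub_of_mem_graph _ hz, sub_add_cancel, zero_add] using h
  refine Metric.tendsto_atTop.2 fun ε hε => ?_
  have hM := Y.nonneg
  obtain ⟨y, hy, hxy⟩ := Metric.mem_closure_iff.1 hx (ε / (2 * (M + 1))) (by positivity)
  obtain ⟨N, hN⟩ := Metric.tendsto_atTop.1 (key y hy) (ε / 2) (by positivity)
  refine ⟨N, fun n hn => ?_⟩
  have h1 := dist_triangle4 (Y.J n x) (Y.J n y) y x
  have h2 : dist (Y.J n x) (Y.J n y) ≤ M * dist x y := by
    rw [dist_eq_norm, dist_eq_norm, ← map_sub]; exact Y.norm_J_apply_le n _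
  rw [lt_div_iff₀ (by positivity)] at hxy
  rw [dist_comm y x] at h1
  linarith [hN n hn]

theorem S_zero (n : ℕ) : Y.S n 0 = 1 := by simp [S]

variable [CompleteSpace E]

theorem hasDerivAt_S (n : ℕ) (t : ℝ) : HasDerivAt (Y.S n) (Y.S n t * Y.B n) t :=
  hasDerivAt_exp_smul_const (𝕂 := ℝ) (Y.B n) t

/-- The path `r ↦ S m (t - r) (S n r x)` joins the two vectors, and by commutation its derivative is
`S m (t - r) (S n r (B n x - B m x))`. -/
theorem norm_S_apply_sub_le (m n : ℕ) {t : ℝ} (ht : t ∈ Icc 0 T) (x : E) :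
    ‖Y.S n t x - Y.S m t x‖ ≤ M * (M * ‖Y.B n x - Y.B m x‖) * t := by
  set φ : ℝ → E := fun r => Y.S m (t - r) (Y.S n r x) with hφ
  have hd : ∀ r, HasDerivAt φ (Y.S m (t - r) (Y.S n r (Y.B n x - Y.B m x))) r := by
    intro r
    have h1 : HasDerivAt (fun r => Y.S n r x) (Y.S n r (Y.B n x)) r := by
      simpa using hasDerivAt_complex_clm_apply (Y.hasDerivAt_S n r) (hasDerivAt_const r x)
    have h2 : HasDerivAt (fun r => Y.S m (t - r)) (-(Y.S m (t - r) * Y.B m)) r := by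
      simpa using (Y.hasDerivAt_S m (t - r)).comp_const_sub t r
    have h3 : HasDerivAt φ _ r := hasDerivAt_complex_clm_apply h2 h1
    refine h3.congr_deriv ?_
    have h4 : Y.B m (Y.S n r x) = Y.S n r (Y.B m x) :=
      DFunLike.congr_fun (Y.commute_B_S m n r).eq x
    simp [h4]
    abel
  have h := norm_image_sub_le_of_norm_deriv_le_segment' (f := φ) (a := 0) (b := t)
    (C := M * (M * ‖Y.B n x - Y.B m x‖)) (fun r _ => (hd r).hasDerivWithinAt) (fun r hr => by
      have hr1 : t - r ∈ Icc 0 T := ⟨by linarith [hr.2], by linarith [hr.1, ht.2]⟩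
      have hr2 : r ∈ Icc 0 T := ⟨hr.1, by linarith [hr.2, ht.2]⟩
      exact (Y.norm_S_apply_le m hr1 _).trans
        (mul_le_mul_of_nonneg_left (Y.norm_S_apply_le n hr2 _) Y.nonneg)) t ⟨ht.1, le_rfl⟩
  simpa [hφ, S_zero] using h

/-- If `A y` lies in the closure of `D(A)`, then `B n y = J n (A y)` converges and the comparison
estimate applies. Two density steps give the rest: from `closure D(A)` to `D(A)`, and from `y` in
`D(A)` to the vectors `J m y`, for which `A (J m y) = J m (A y)` is in `D(A)`. -/
theorem cauchySeq_S {t : ℝ} (ht : t ∈ Icc 0 T) {x : E} (hx : x ∈ closure (A.domain : Set E)) :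
    CauchySeq fun n => Y.S n t x := by
  have key : ∀ y z, (y, z) ∈ A.graph → z ∈ closure (A.domain : Set E) →
      CauchySeq fun n => Y.S n t y := by
    intro y z hyz hz
    have hc : CauchySeq fun n => Y.B n y := by
      simpa only [Y.B_apply_of_mem_graph _ hyz] using (Y.tendsto_J_apply hz).cauchySeq
    have hM := Y.nonneg
    refine Metric.cauchySeq_iff'.2 fun ε hε => ?_
    obtain ⟨N, hN⟩ := Metric.cauchySeq_iff'.1 hc (ε / (M * M * t + 1))
      (by have := ht.1; positivity)
    refine ⟨N, fun n hn => ?_⟩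
    have h1 := hN n hn
    rw [lt_div_iff₀ (by have := ht.1; positivity), dist_eq_norm] at h1
    rw [dist_eq_norm]
    nlinarith [Y.norm_S_apply_sub_le N n ht y, norm_nonneg (Y.B n y - Y.B N y)]
  have hbd : ∀ n y, ‖Y.S n t y‖ ≤ M * ‖y‖ := fun n y => Y.norm_S_apply_le n ht y
  refine cauchySeq_apply_of_mem_closure Y.nonneg hbd (fun y hy => ?_) hx
  refine cauchySeq_apply_of_mem_closure Y.nonneg hbd (s := range fun m => Y.J m y) ?_
    (mem_closure_of_tendsto (Y.tendsto_J_apply (subset_closure hy)) (.of_forall mem_range_self))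
  rintro _ ⟨m, rfl⟩
  obtain ⟨z, hz⟩ := LinearPMap.mem_domain_iff.1 hy
  refine key _ _ (Y.J_mem_graph m y) (subset_closure ?_)
  rw [Y.B_apply_of_mem_graph m hz]
  exact Y.J_mem_domain m z

end YosidaSystem

end Resolvent

/-! ### Variation of constants for bounded generators and integrable sources. -/

section Duhamel

variable {E : Type*} [NormedAddCommGroup E] [NormedSpace ℂ E]

theorem intervalIntegrable_clm_apply {L : ℝ → E →L[ℂ] E} {g : ℝ → E} {a b : ℝ}
    (hL : Continuous L) (hg : IntervalIntegrable g volume a b) :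
    IntervalIntegrable (fun s => L s (g s)) volume a b := by
  obtain ⟨c, hc⟩ := isCompact_uIcc.exists_bound_of_continuousOn (s := uIcc a b) hL.continuousOn
  rw [intervalIntegrable_iff] at hg ⊢
  refine Integrable.mono' (hg.norm.const_mul c) ?_ ?_
  · exact isBoundedBilinearMap_apply.continuous.comp_aestronglyMeasurable
      (hL.aestronglyMeasurable.prodMk hg.aestronglyMeasurable)
  · refine (ae_restrict_iff' measurableSet_uIoc).2 (.of_forall fun s hs => ?_)
    exact (L s).le_of_opNorm_le (hc s (uIoc_subset_uIcc hs)) _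

theorem norm_intervalIntegral_clm_apply_le {L : ℝ → E →L[ℂ] E} {g : ℝ → E} {t c : ℝ}
    (ht : 0 ≤ t) (hc : ∀ s ∈ Icc 0 t, ‖L s‖ ≤ c) (hg : IntervalIntegrable g volume 0 t) :
    ‖∫ s in (0 : ℝ)..t, L s (g s)‖ ≤ c * ∫ s in (0 : ℝ)..t, ‖g s‖ := by
  rw [← intervalIntegral.integral_const_mul]
  refine intervalIntegral.norm_integral_le_of_norm_le ht (.of_forall fun s hs => ?_)
    (hg.norm.const_mul c)
  exact (L s).le_of_opNorm_le (hc s (Ioc_subset_Icc_self hs)) _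

theorem IntervalIntegrable.continuousOn_primitive {g : ℝ → E} {T : ℝ} (hT : 0 ≤ T)
    (hg : IntervalIntegrable g volume 0 T) :
    ContinuousOn (fun s => ∫ r in (0 : ℝ)..s, g r) (Icc 0 T) := by
  have h := intervalIntegral.continuousOn_primitive_interval' hg left_mem_uIcc
  rwa [uIcc_of_le hT] at h

theorem IntervalIntegrable.mono_right {g : ℝ → E} {t T : ℝ} (ht : t ∈ Icc 0 T)
    (hg : IntervalIntegrable g volume 0 T) : IntervalIntegrable g volume 0 t :=
  hg.mono_set (by rw [uIcc_of_le ht.1, uIcc_of_le (ht.1.trans ht.2)]; exact Icc_subset_Icc_right ht.2)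

theorem norm_primitive_le {g : ℝ → E} {t T : ℝ} (ht : t ∈ Icc 0 T)
    (hg : IntervalIntegrable g volume 0 T) :
    ‖∫ r in (0 : ℝ)..t, g r‖ ≤ ∫ r in (0 : ℝ)..T, ‖g r‖ :=
  (intervalIntegral.norm_integral_le_integral_norm ht.1).trans
    (intervalIntegral.integral_mono_interval le_rfl ht.1 ht.2
      (.of_forall fun _ => norm_nonneg _) hg.norm)

variable [CompleteSpace E]

/-- Continuous functions are dense in `L^1(0, t)`. -/
theorem exists_continuous_integral_norm_sub_le {g : ℝ → E} {t : ℝ} (ht : 0 ≤ t)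
    (hg : IntervalIntegrable g volume 0 t) {ε : ℝ} (hε : 0 < ε) :
    ∃ k : ℝ → E, ContDiff ℝ 1 k ∧ ∫ s in (0 : ℝ)..t, ‖g s - k s‖ ≤ ε := by
  have h1 : MemLp g 1 (volume.restrict (Ioc 0 t)) :=
    memLp_one_iff_integrable.2 ((intervalIntegrable_iff_integrableOn_Ioc_of_le ht).1 hg)
  obtain ⟨k, -, hk, hle⟩ := h1.exist_eLpNorm_sub_le ENNReal.one_ne_top le_rfl hε
  refine ⟨k, hk.of_le (by exact_mod_cast le_top), ?_⟩
  have h2 : IntegrableOn (g - k) (Ioc 0 t) :=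
    ((intervalIntegrable_iff_integrableOn_Ioc_of_le ht).1
      (hg.sub (hk.continuous.intervalIntegrable 0 t)))
  rw [intervalIntegral.integral_of_le ht]
  rw [eLpNorm_one_eq_lintegral_enorm, ← ofReal_integral_norm_eq_lintegral_enorm h2,
    ENNReal.ofReal_le_ofReal_iff hε.le] at hle
  exact hle

/-- Integration by parts for a `C^1` family of operators and an integrable function. -/
theorem integral_clm_apply_parts {Φ Φ' : ℝ → E →L[ℂ] E} (hΦ : ∀ s, HasDerivAt Φ (Φ' s) s)
    (hΦ' : Continuous Φ') {g : ℝ → E} {t : ℝ} (ht : 0 ≤ t)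
    (hg : IntervalIntegrable g volume 0 t) :
    ∫ s in (0 : ℝ)..t, Φ s (g s) =
      Φ t (∫ s in (0 : ℝ)..t, g s) - ∫ s in (0 : ℝ)..t, Φ' s (∫ r in (0 : ℝ)..s, g r) := by
  have hΦc : Continuous Φ := continuous_iff_continuousAt.2 fun s => (hΦ s).continuousAt
  -- For continuous `k` the primitive is differentiable everywhere, and the formula is the
  -- fundamental theorem of calculus for a product.
  have hcont : ∀ k : ℝ → E, Continuous k → ∫ s in (0 : ℝ)..t, Φ s (k s) =
      Φ t (∫ s in (0 : ℝ)..t, k s) - ∫ s in (0 : ℝ)..t, Φ' s (∫ r in (0 : ℝ)..s, k r) := by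
    intro k hk
    have hK : ∀ s, HasDerivAt (fun s => ∫ r in (0 : ℝ)..s, k r) (k s) s := fun s =>
      intervalIntegral.integral_hasDerivAt_right (hk.intervalIntegrable _ _)
        hk.stronglyMeasurable.stronglyMeasurableAtFilter hk.continuousAt
    have hKc : Continuous fun s => ∫ r in (0 : ℝ)..s, k r :=
      continuous_iff_continuousAt.2 fun s => (hK s).continuousAt
    have h := intervalIntegral.integral_eq_sub_of_hasDerivAt
      (fun s _ => hasDerivAt_complex_clm_apply (hΦ s) (hK s))
      (((hΦ'.clm_apply hKc).add (hΦc.clm_apply hk)).intervalIntegrable 0 t)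
    rw [intervalIntegral.integral_add ((hΦ'.clm_apply hKc).intervalIntegrable 0 t)
      ((hΦc.clm_apply hk).intervalIntegrable 0 t)] at h
    simp only [intervalIntegral.integral_same, map_zero, sub_zero] at h
    rw [← h]; abel
  -- The defect of the formula is bounded by the `L^1` norm and vanishes on continuous functions,
  -- which are dense.
  let H : (ℝ → E) → E := fun g => (∫ s in (0 : ℝ)..t, Φ s (g s)) -
    (Φ t (∫ s in (0 : ℝ)..t, g s) - ∫ s in (0 : ℝ)..t, Φ' s (∫ r in (0 : ℝ)..s, g r))
  obtain ⟨c, hc⟩ := isCompact_Icc.exists_bound_of_continuousOn (s := Icc 0 t) hΦc.continuousOn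
  obtain ⟨c', hc'⟩ := isCompact_Icc.exists_bound_of_continuousOn (s := Icc 0 t) hΦ'.continuousOn
  have hc'0 : 0 ≤ c' := (norm_nonneg _).trans (hc' 0 ⟨le_rfl, ht⟩)
  have hc0 : 0 ≤ c := (norm_nonneg _).trans (hc 0 ⟨le_rfl, ht⟩)
  have hprim : ∀ f : ℝ → E, IntervalIntegrable f volume 0 t →
      IntervalIntegrable (fun s => ∫ r in (0 : ℝ)..s, f r) volume 0 t := fun f hf =>
    (IntervalIntegrable.continuousOn_primitive ht hf).intervalIntegrable_of_Icc ht
  have hbd : ∀ f, IntervalIntegrable f volume 0 t →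
      ‖H f‖ ≤ (c + (c + c' * t)) * ∫ s in (0 : ℝ)..t, ‖f s‖ := by
    intro f hf
    have h1 := norm_intervalIntegral_clm_apply_le ht hc hf
    have h2 : ‖Φ t (∫ s in (0 : ℝ)..t, f s)‖ ≤ c * ∫ s in (0 : ℝ)..t, ‖f s‖ :=
      ((Φ t).le_of_opNorm_le (hc t ⟨ht, le_rfl⟩) _).trans
        (mul_le_mul_of_nonneg_left (norm_primitive_le ⟨ht, le_rfl⟩ hf) hc0)
    have h3 := norm_intervalIntegral_clm_apply_le ht hc' (hprim f hf)
    have h4 : ∫ s in (0 : ℝ)..t, ‖∫ r in (0 : ℝ)..s, f r‖ ≤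
        ∫ _ in (0 : ℝ)..t, ∫ s in (0 : ℝ)..t, ‖f s‖ :=
      intervalIntegral.integral_mono_on ht (hprim f hf).norm (by simp)
        fun s hs => norm_primitive_le hs hf
    rw [intervalIntegral.integral_const, sub_zero, smul_eq_mul] at h4
    calc _ ≤ _ := (norm_sub_le _ _).trans (add_le_add h1 ((norm_sub_le _ _).trans
            (add_le_add h2 (h3.trans (mul_le_mul_of_nonneg_left h4 hc'0)))))
      _ = _ := by ring
  have hsub : ∀ k : ℝ → E, Continuous k → H (fun s => g s - k s) = H g - H k := by
    intro k hk
    have hk' := hk.intervalIntegrable (μ := volume) 0 t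
    have e1 : ∫ s in (0 : ℝ)..t, Φ s (g s - k s) =
        (∫ s in (0 : ℝ)..t, Φ s (g s)) - ∫ s in (0 : ℝ)..t, Φ s (k s) := by
      simp only [map_sub]
      exact intervalIntegral.integral_sub (intervalIntegrable_clm_apply hΦc hg)
        (intervalIntegrable_clm_apply hΦc hk')
    have e2 : ∫ s in (0 : ℝ)..t, Φ' s (∫ r in (0 : ℝ)..s, (g r - k r)) =
        (∫ s in (0 : ℝ)..t, Φ' s (∫ r in (0 : ℝ)..s, g r)) -
          ∫ s in (0 : ℝ)..t, Φ' s (∫ r in (0 : ℝ)..s, k r) := by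
      rw [← intervalIntegral.integral_sub (intervalIntegrable_clm_apply hΦ' (hprim g hg))
        (intervalIntegrable_clm_apply hΦ' (hprim k hk'))]
      refine intervalIntegral.integral_congr fun s hs => ?_
      rw [uIcc_of_le ht] at hs
      rw [intervalIntegral.integral_sub (IntervalIntegrable.mono_right hs hg)
        (hk.intervalIntegrable 0 s), map_sub]
    dsimp only [H]
    rw [e1, e2, intervalIntegral.integral_sub hg hk', map_sub]
    abel
  have h0 : ‖H g‖ ≤ 0 := by
    refine le_of_forall_pos_le_add fun ε hε => ?_
    set K := c + (c + c' * t) with hK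
    have hK0 : 0 ≤ K := by positivity
    obtain ⟨k, hk, hgk⟩ := exists_continuous_integral_norm_sub_le ht hg
      (ε := ε / (K + 1)) (by positivity)
    have h1 := hbd _ (hg.sub (hk.continuous.intervalIntegrable 0 t))
    have h2 : H k = 0 := sub_eq_zero.2 (hcont k hk.continuous)
    rw [hsub k hk.continuous, h2, sub_zero] at h1
    rw [le_div_iff₀ (by positivity)] at hgk
    have h3 : 0 ≤ ∫ s in (0 : ℝ)..t, ‖g s - k s‖ :=
      intervalIntegral.integral_nonneg ht fun _ _ => norm_nonneg _
    nlinarith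
  exact sub_eq_zero.1 (norm_le_zero_iff.1 h0)

variable (B : E →L[ℂ] E)

theorem hasDerivAt_exp_smul (t : ℝ) : HasDerivAt (fun t : ℝ => NormedSpace.exp (t • B))
    (NormedSpace.exp (t • B) * B) t :=
  hasDerivAt_exp_smul_const (𝕂 := ℝ) B t

theorem continuous_exp_smul : Continuous fun t : ℝ => NormedSpace.exp (t • B) :=
  continuous_iff_continuousAt.2 fun t => (hasDerivAt_exp_smul B t).continuousAt

theorem exp_add_smul (s t : ℝ) : NormedSpace.exp ((s + t) • B) =
    NormedSpace.exp (s • B) * NormedSpace.exp (t • B) := by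
  let _ : NormedAlgebra ℚ (E →L[ℂ] E) := NormedAlgebra.restrictScalars ℚ ℝ _
  rw [add_smul, NormedSpace.exp_add_of_commute]
  exact ((Commute.refl B).smul_left s).smul_right t

theorem exp_smul_exp_neg_smul (t : ℝ) (x : E) :
    NormedSpace.exp (t • B) (NormedSpace.exp ((-t) • B) x) = x := by
  have h := exp_add_smul B t (-t)
  rw [add_neg_cancel, zero_smul, NormedSpace.exp_zero] at h
  exact (DFunLike.congr_fun h x).symm

theorem commute_exp_smul {B R : E →L[ℂ] E} (h : Commute R B) (t : ℝ) :
    Commute R (NormedSpace.exp (t • B)) := by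
  let _ : NormedAlgebra ℚ (E →L[ℂ] E) := NormedAlgebra.restrictScalars ℚ ℝ _
  exact (h.smul_right t).exp_right

/-- The convolution `∫_0^t e^{(t - s) B} g(s) ds`. -/
def duhamel (g : ℝ → E) (t : ℝ) : E :=
  ∫ s in (0 : ℝ)..t, NormedSpace.exp ((t - s) • B) (g s)

variable {B}

theorem duhamel_integrand {g : ℝ → E} {t : ℝ} (hg : IntervalIntegrable g volume 0 t) (r : ℝ) :
    IntervalIntegrable (fun s => NormedSpace.exp ((r - s) • B) (g s)) volume 0 t :=
  intervalIntegrable_clm_apply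
    ((continuous_exp_smul B).comp (continuous_const.sub continuous_id)) hg

/-- Removing `t` from the integrand leaves a primitive, which makes continuity in `t` and
integration by parts accessible. -/
theorem duhamel_eq {g : ℝ → E} {t : ℝ} (hg : IntervalIntegrable g volume 0 t) :
    duhamel B g t =
      NormedSpace.exp (t • B) (∫ s in (0 : ℝ)..t, NormedSpace.exp ((-s) • B) (g s)) := by
  have h := duhamel_integrand (B := B) hg 0
  simp only [zero_sub] at h
  rw [← ContinuousLinearMap.intervalIntegral_comp_comm _ h]
  refine intervalIntegral.integral_congr fun s _ => ?_
  rw [sub_eq_add_neg, exp_add_smul]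
  rfl

theorem duhamel_sub {g k : ℝ → E} {t : ℝ} (hg : IntervalIntegrable g volume 0 t)
    (hk : IntervalIntegrable k volume 0 t) :
    duhamel B (fun s => g s - k s) t = duhamel B g t - duhamel B k t := by
  simp only [duhamel, map_sub]
  exact intervalIntegral.integral_sub (duhamel_integrand hg t) (duhamel_integrand hk t)

theorem duhamel_comp_commute {R : E →L[ℂ] E} (h : Commute R B) {g : ℝ → E} {t : ℝ}
    (hg : IntervalIntegrable g volume 0 t) :
    R (duhamel B g t) = duhamel B (fun s => R (g s)) t := by
  rw [duhamel, ← ContinuousLinearMap.intervalIntegral_comp_comm _ (duhamel_integrand hg t)]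
  refine intervalIntegral.integral_congr fun s _ => ?_
  exact DFunLike.congr_fun (commute_exp_smul h (t - s)).eq (g s)

theorem norm_duhamel_le {M T : ℝ} (hM : ∀ t ∈ Icc 0 T, ‖NormedSpace.exp (t • B)‖ ≤ M)
    {g : ℝ → E} {t : ℝ} (ht : t ∈ Icc 0 T) (hg : IntervalIntegrable g volume 0 t) :
    ‖duhamel B g t‖ ≤ M * ∫ s in (0 : ℝ)..t, ‖g s‖ :=
  norm_intervalIntegral_clm_apply_le ht.1
    (fun s hs => hM _ ⟨sub_nonneg.2 hs.2, by linarith [hs.1, ht.2]⟩) hg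

theorem continuousOn_duhamel {g : ℝ → E} {T : ℝ} (hT : 0 ≤ T)
    (hg : IntervalIntegrable g volume 0 T) : ContinuousOn (duhamel B g) (Icc 0 T) := by
  have h := duhamel_integrand (B := B) hg 0
  simp only [zero_sub] at h
  refine ((continuous_exp_smul B).continuousOn.clm_apply
    (IntervalIntegrable.continuousOn_primitive hT h)).congr fun t ht => ?_
  exact duhamel_eq (IntervalIntegrable.mono_right ht hg)

/-- The variation of constants formula for an absolutely continuous function. -/
theorem eq_exp_add_duhamel {g : ℝ → E} {w₀ : E} {t : ℝ} (ht : 0 ≤ t)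
    (hg : IntervalIntegrable g volume 0 t) :
    w₀ + ∫ s in (0 : ℝ)..t, g s = NormedSpace.exp (t • B) w₀ +
      duhamel B (fun s => g s - B (w₀ + ∫ r in (0 : ℝ)..s, g r)) t := by
  set Φ : ℝ → E →L[ℂ] E := fun s => NormedSpace.exp ((-s) • B) with hΦdef
  have hΦ : ∀ s, HasDerivAt Φ (-(NormedSpace.exp ((-s) • B) * B)) s := fun s => by
    have h := (hasDerivAt_exp_smul B (-s)).scomp s (hasDerivAt_neg s)
    rwa [neg_one_smul] at h
  have hΦc : Continuous Φ := (continuous_exp_smul B).comp continuous_neg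
  have hΦ' : Continuous fun s => -(Φ s * B) := (hΦc.mul continuous_const).neg
  have hG := (IntervalIntegrable.continuousOn_primitive ht hg)
  have hw : IntervalIntegrable (fun s => w₀ + ∫ r in (0 : ℝ)..s, g r) volume 0 t :=
    (continuousOn_const.add hG).intervalIntegrable_of_Icc ht
  have h1 := integral_clm_apply_parts hΦ hΦ' ht hg
  have h2 : ∫ s in (0 : ℝ)..t, (-(Φ s * B)) w₀ = Φ t w₀ - w₀ := by
    have := intervalIntegral.integral_eq_sub_of_hasDerivAt (f := fun s => Φ s w₀)
      (f' := fun s => (-(Φ s * B)) w₀) (fun s _ => by simpa [hΦdef] using hasDerivAt_complex_clm_apply (hΦ s) (hasDerivAt_const s w₀))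
      ((hΦ'.clm_apply (continuous_const (y := w₀))).intervalIntegrable 0 t)
    rw [this]
    simp [hΦdef]
  -- With `w` the function `w₀ + ∫ g`, this is the integrated form of `(e^{-sB} w)' = e^{-sB} (w' -
  -- B w)`.
  have h3 : ∫ s in (0 : ℝ)..t, Φ s (g s - B (w₀ + ∫ r in (0 : ℝ)..s, g r)) =
      Φ t (w₀ + ∫ s in (0 : ℝ)..t, g s) - w₀ := by
    have e : ∀ s, Φ s (g s - B (w₀ + ∫ r in (0 : ℝ)..s, g r)) =
        Φ s (g s) + ((-(Φ s * B)) w₀ + (-(Φ s * B)) (∫ r in (0 : ℝ)..s, g r)) := fun s => by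
      simp [map_sub, map_add]; abel
    have i1 := intervalIntegrable_clm_apply hΦ'
      (intervalIntegrable_const (μ := volume) (a := 0) (b := t) (c := w₀))
    have i2 := intervalIntegrable_clm_apply hΦ' (hG.intervalIntegrable_of_Icc (μ := volume) ht)
    simp only [e]
    rw [intervalIntegral.integral_add (intervalIntegrable_clm_apply hΦc hg) (i1.add i2),
      intervalIntegral.integral_add i1 i2, h1, h2, map_add]
    abel
  have hB : IntervalIntegrable (fun s => g s - B (w₀ + ∫ r in (0 : ℝ)..s, g r)) volume 0 t :=
    hg.sub (intervalIntegrable_clm_apply (continuous_const (y := B)) hw)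
  rw [duhamel_eq hB]
  change _ = _ + NormedSpace.exp (t • B) (∫ s in (0 : ℝ)..t, Φ s _)
  rw [h3, map_sub, exp_smul_exp_neg_smul]
  abel

/-- Mild solutions of an equation with bounded generator are integral solutions. -/
theorem exp_add_duhamel_eq {g : ℝ → E} {v₀ : E} {t : ℝ} (ht : 0 ≤ t)
    (hg : IntervalIntegrable g volume 0 t) :
    NormedSpace.exp (t • B) v₀ + duhamel B g t = v₀ + (∫ s in (0 : ℝ)..t, g s) +
      B (∫ s in (0 : ℝ)..t, (NormedSpace.exp (s • B) v₀ + duhamel B g s)) := by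
  set Φ : ℝ → E →L[ℂ] E := fun s => NormedSpace.exp (s • B) with hΦdef
  have hΦ : ∀ s, HasDerivAt Φ (Φ s * B) s := hasDerivAt_exp_smul B
  have hΦc : Continuous Φ := continuous_exp_smul B
  have hΦ' : Continuous fun s => Φ s * B := hΦc.mul continuous_const
  have hk := duhamel_integrand (B := B) hg 0
  simp only [zero_sub] at hk
  -- The parts formula is applied to `e^{-sB} g(s)`: multiplied by `Φ s` it becomes `g s`, and `Φ s`
  -- applied to its primitive is the convolution.
  have h1 := integral_clm_apply_parts hΦ hΦ' ht hk
  have h2 : ∫ s in (0 : ℝ)..t, (Φ s * B) v₀ = Φ t v₀ - v₀ := by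
    have := intervalIntegral.integral_eq_sub_of_hasDerivAt (f := fun s => Φ s v₀)
      (f' := fun s => (Φ s * B) v₀) (fun s _ => by simpa using hasDerivAt_complex_clm_apply (hΦ s) (hasDerivAt_const s v₀))
      ((hΦ'.clm_apply (continuous_const (y := v₀))).intervalIntegrable 0 t)
    rw [this]
    simp [hΦdef]
  have hcomm : ∀ s x, (Φ s * B) x = B (Φ s x) := fun s x =>
    (DFunLike.congr_fun (commute_exp_smul (Commute.refl B) s).eq x).symm
  have e1 : ∫ s in (0 : ℝ)..t, Φ s (NormedSpace.exp ((-s) • B) (g s)) = ∫ s in (0 : ℝ)..t, g s :=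
    intervalIntegral.integral_congr fun s _ => exp_smul_exp_neg_smul B s (g s)
  have e2 : ∫ s in (0 : ℝ)..t, (Φ s * B) (∫ r in (0 : ℝ)..s, NormedSpace.exp ((-r) • B) (g r)) =
      B (∫ s in (0 : ℝ)..t, duhamel B g s) := by
    rw [← ContinuousLinearMap.intervalIntegral_comp_comm _
      ((continuousOn_duhamel ht hg).intervalIntegrable_of_Icc ht)]
    refine intervalIntegral.integral_congr fun s hs => ?_
    rw [uIcc_of_le ht] at hs
    rw [hcomm, duhamel_eq (IntervalIntegrable.mono_right hs hg)]
  have e3 : ∫ s in (0 : ℝ)..t, (Φ s * B) v₀ = B (∫ s in (0 : ℝ)..t, Φ s v₀) := by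
    rw [← ContinuousLinearMap.intervalIntegral_comp_comm _
      ((hΦc.clm_apply continuous_const).intervalIntegrable 0 t)]
    exact intervalIntegral.integral_congr fun s _ => hcomm s v₀
  rw [intervalIntegral.integral_add ((hΦc.clm_apply continuous_const).intervalIntegrable 0 t)
    ((continuousOn_duhamel ht hg).intervalIntegrable_of_Icc ht), map_add, ← e2, ← e3, h2,
    duhamel_eq hg, ← e1, h1]
  abel

end Duhamel

/-! ### Limits of the Yosida approximations: convolutions, strict solutions, a priori bound. -/

theorem cauchySeq_sub {F : Type*} [SeminormedAddCommGroup F] {a b : ℕ → F} (ha : CauchySeq a)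
    (hb : CauchySeq b) : CauchySeq fun n => a n - b n :=
  uniformContinuous_sub.comp_cauchySeq (ha.prodMk hb)

namespace YosidaSystem

variable {E : Type*} [NormedAddCommGroup E] [NormedSpace ℂ E] [CompleteSpace E]
  {A : E →ₗ.[ℂ] E} {T M : ℝ} (Y : YosidaSystem A T M)

theorem B_J_apply_sub (n : ℕ) (x : E) : (Y.lam n)⁻¹ • Y.B n x = Y.J n x - x := by
  rw [B_apply, inv_smul_smul₀ (Y.lam_pos n).ne']

/-- The integrands converge pointwise because `g` stays where the semigroups converge, and `M * ‖g
s‖` dominates them. -/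
theorem cauchySeq_duhamel_of_mem_closure {g : ℝ → E} {t : ℝ} (ht : t ∈ Icc 0 T)
    (hg : IntervalIntegrable g volume 0 t) (hcl : ∀ s, g s ∈ closure (A.domain : Set E)) :
    CauchySeq fun n => duhamel (Y.B n) g t := by
  have hmem : ∀ s ∈ Icc 0 t, t - s ∈ Icc 0 T := fun s hs =>
    ⟨sub_nonneg.2 hs.2, by linarith [hs.1, ht.2]⟩
  have hlim : ∀ s, ∃ y, s ∈ Icc 0 t → Tendsto (fun n => Y.S n (t - s) (g s)) atTop (𝓝 y) := by
    intro s
    by_cases hs : s ∈ Icc 0 t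
    · obtain ⟨y, hy⟩ := cauchySeq_tendsto_of_complete (Y.cauchySeq_S (hmem s hs) (hcl s))
      exact ⟨y, fun _ => hy⟩
    · exact ⟨0, fun h => absurd h hs⟩
  choose φ hφ using hlim
  refine Tendsto.cauchySeq (x := ∫ s in (0 : ℝ)..t, φ s) ?_
  refine intervalIntegral.tendsto_integral_filter_of_dominated_convergence (fun s => M * ‖g s‖)
    (.of_forall fun n => (duhamel_integrand hg t).def'.aestronglyMeasurable)
    (.of_forall fun n => .of_forall fun s hs => ?_) (hg.norm.const_mul M)
    (.of_forall fun s hs => ?_)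
  · rw [uIoc_of_le ht.1] at hs
    exact Y.norm_S_apply_le n (hmem s (Ioc_subset_Icc_self hs)) _
  · rw [uIoc_of_le ht.1] at hs
    exact hφ s (Ioc_subset_Icc_self hs)

theorem norm_duhamel_le (n : ℕ) {g : ℝ → E} {t : ℝ} (ht : t ∈ Icc 0 T)
    (hg : IntervalIntegrable g volume 0 t) :
    ‖duhamel (Y.B n) g t‖ ≤ M * ∫ s in (0 : ℝ)..t, ‖g s‖ :=
  UltraCauchy.norm_duhamel_le (Y.norm_exp_le n) ht hg

/-- Here `k` may leave the closure of `D(A)`. Smoothness makes `B n` of the convolution bounded in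
`n`, and this allows the convolution to be recovered from its image under the single resolvent `R
0`, where everything has values in `D(A)`. -/
theorem cauchySeq_duhamel_of_contDiff {k : ℝ → E} (hk : ContDiff ℝ 1 k) {t : ℝ}
    (ht : t ∈ Icc 0 T) : CauchySeq fun n => duhamel (Y.B n) k t := by
  have hk' : Continuous (deriv k) := hk.continuous_deriv le_rfl
  have hki : IntervalIntegrable k volume 0 t := hk.continuous.intervalIntegrable 0 t
  have hki' : IntervalIntegrable (deriv k) volume 0 t := hk'.intervalIntegrable 0 t
  have hFTC : ∀ s, k 0 + ∫ r in (0 : ℝ)..s, deriv k r = k s := fun s => by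
    rw [intervalIntegral.integral_deriv_eq_sub
      (fun r _ => (hk.differentiable one_ne_zero).differentiableAt)
      (hk'.intervalIntegrable 0 s)]
    abel
  -- This is `B n` of the convolution, read off from the variation of constants formula for `k`
  -- itself.
  set b : ℕ → E := fun n => Y.S n t (k 0) + duhamel (Y.B n) (deriv k) t - k t with hb
  have hBv : ∀ n, Y.B n (duhamel (Y.B n) k t) = b n := by
    intro n
    have h1 := eq_exp_add_duhamel (B := Y.B n) (w₀ := k 0) ht.1 hki'
    simp only [hFTC] at h1
    rw [duhamel_sub hki' (intervalIntegrable_clm_apply continuous_const hki),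
      ← duhamel_comp_commute (Commute.refl _) hki] at h1
    simp only [hb]
    rw [eq_sub_iff_add_eq, h1]
    simp only [S]
    abel
  -- For the convolution `v` one has `R 0 (B n v) = J n d` with `d = J 0 v - v`, and `J n d - d =
  -- (lam n)⁻¹ • B n d`. The first two terms of the representation are Cauchy and the last is
  -- `O((lam n)⁻¹)`.
  have hrep : ∀ n, duhamel (Y.B n) k t = Y.J 0 (duhamel (Y.B n) k t) - Y.R 0 (b n) +
      (Y.lam n)⁻¹ • (Y.J 0 (b n) - b n) := by
    intro n
    rw [← hBv n]
    set v := duhamel (Y.B n) k t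
    have h1 : Y.B n (Y.R 0 v) = Y.J n (Y.J 0 v - v) :=
      Y.B_apply_of_mem_graph n (Y.R_mem_graph 0 v)
    have h2 : Y.R 0 (Y.B n v) = Y.B n (Y.R 0 v) := DFunLike.congr_fun (Y.commute_R_B 0 n).eq v
    have h3 : Y.J 0 (Y.B n v) = Y.B n (Y.J 0 v) :=
      DFunLike.congr_fun ((Y.commute_R_B 0 n).smul_left (Y.lam 0)).eq v
    rw [h2, h1, h3, ← map_sub, Y.B_J_apply_sub]
    abel
  have hR : ∀ {g : ℝ → E}, IntervalIntegrable g volume 0 t →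
      CauchySeq fun n => Y.R 0 (duhamel (Y.B n) g t) := fun hg => by
    simp only [duhamel_comp_commute (Y.commute_R_B 0 _) hg]
    exact Y.cauchySeq_duhamel_of_mem_closure ht
      (intervalIntegrable_clm_apply continuous_const hg)
      fun s => subset_closure (Y.R_mem_domain 0 _)
  have hc1 : CauchySeq fun n => Y.J 0 (duhamel (Y.B n) k t) :=
    ((Y.lam 0 • ContinuousLinearMap.id ℂ E : E →L[ℂ] E).uniformContinuous).comp_cauchySeq
      (hR hki)
  have hc2 : CauchySeq fun n => Y.R 0 (b n) := by
    have h1 : ∀ n, Y.R 0 (Y.S n t (k 0)) = Y.S n t (Y.R 0 (k 0)) := fun n =>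
      DFunLike.congr_fun (Y.commute_R_S 0 n t).eq _
    simp only [hb, map_sub, map_add, h1]
    exact cauchySeq_sub
      ((Y.cauchySeq_S ht (subset_closure (Y.R_mem_domain 0 _))).add (hR hki')) (cauchySeq_const _)
  have hc3 : Tendsto (fun n => (Y.lam n)⁻¹ • (Y.J 0 (b n) - b n)) atTop (𝓝 0) := by
    have hM := Y.nonneg
    set c := M * ‖k 0‖ + M * (∫ s in (0 : ℝ)..t, ‖deriv k s‖) + ‖k t‖
    have hbn : ∀ n, ‖b n‖ ≤ c := fun n => (norm_sub_le _ _).trans (add_le_add_left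
      ((norm_add_le _ _).trans (add_le_add (Y.norm_S_apply_le n ht _)
        (Y.norm_duhamel_le n ht hki'))) _)
    have h1 : ∀ n, ‖(Y.lam n)⁻¹ • (Y.J 0 (b n) - b n)‖ ≤ (Y.lam n)⁻¹ * (M * c + c) := fun n => by
      rw [norm_smul, Real.norm_of_nonneg (inv_nonneg.2 (Y.lam_pos n).le)]
      refine mul_le_mul_of_nonneg_left ?_ (inv_nonneg.2 (Y.lam_pos n).le)
      exact (norm_sub_le _ _).trans (add_le_add ((Y.norm_J_apply_le 0 _).trans
        (mul_le_mul_of_nonneg_left (hbn n) hM)) (hbn n))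
    refine squeeze_zero_norm h1 ?_
    simpa using Y.tendsto_inv_lam.mul_const (M * c + c)
  have h := (cauchySeq_sub hc1 hc2).add hc3.cauchySeq
  rwa [funext hrep]

/-- The bound by `M` times the `L^1` norm is uniform in `n`, so the `C^1` case extends by density.
-/
theorem cauchySeq_duhamel {g : ℝ → E} {t : ℝ} (ht : t ∈ Icc 0 T)
    (hg : IntervalIntegrable g volume 0 t) : CauchySeq fun n => duhamel (Y.B n) g t := by
  have hM := Y.nonneg
  refine cauchySeq_of_forall_approx fun ε hε => ?_
  obtain ⟨k, hk, hle⟩ := exists_continuous_integral_norm_sub_le ht.1 hg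
    (ε := ε / (M + 1)) (by positivity)
  refine ⟨_, Y.cauchySeq_duhamel_of_contDiff hk ht, fun n => ?_⟩
  have hki := hk.continuous.intervalIntegrable (μ := volume) 0 t
  rw [dist_eq_norm, ← duhamel_sub hg hki]
  have h1 := Y.norm_duhamel_le n ht (hg.sub hki)
  have h2 : 0 ≤ ∫ s in (0 : ℝ)..t, ‖g s - k s‖ :=
    intervalIntegral.integral_nonneg ht.1 fun _ _ => norm_nonneg _
  rw [le_div_iff₀ (by positivity)] at hle
  nlinarith

/-- Existence of strict solutions. -/
theorem exists_strict (Y : YosidaSystem A T M) (hA : A.IsClosed) (hT : 0 ≤ T) {f₀ u₀ a₀ : E} {g : ℝ → E}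
    (hg : IntervalIntegrable g volume 0 T) (hu : (u₀, a₀) ∈ A.graph)
    (hcl : a₀ + f₀ ∈ closure (A.domain : Set E)) :
    ∃ v : ℝ → E, AEStronglyMeasurable v (volume.restrict (Icc 0 T)) ∧
      (∀ t ∈ Icc 0 T, ‖v t‖ ≤ M * (‖a₀ + f₀‖ + ∫ s in (0 : ℝ)..T, ‖g s‖)) ∧
      ∀ t ∈ Icc 0 T, (u₀ + ∫ s in (0 : ℝ)..t, v s, v t - (f₀ + ∫ s in (0 : ℝ)..t, g s)) ∈
        A.graph := by
  have hM := Y.nonneg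
  -- These solve the differentiated equation `v' = B n v + g` with `v(0) = A u₀ + f₀`.
  set vn : ℕ → ℝ → E := fun n t =>
    NormedSpace.exp (t • Y.B n) (a₀ + f₀) + duhamel (Y.B n) g t with hvn
  have hgt : ∀ t ∈ Icc 0 T, IntervalIntegrable g volume 0 t := fun t ht =>
    IntervalIntegrable.mono_right ht hg
  have hlim : ∀ t, ∃ y, t ∈ Icc 0 T → Tendsto (fun n => vn n t) atTop (𝓝 y) := by
    intro t
    by_cases ht : t ∈ Icc 0 T
    · obtain ⟨y, hy⟩ := cauchySeq_tendsto_of_complete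
        ((Y.cauchySeq_S ht hcl).add (Y.cauchySeq_duhamel ht (hgt t ht)))
      exact ⟨y, fun _ => hy⟩
    · exact ⟨0, fun h => absurd h ht⟩
  choose v hv using hlim
  have hcont : ∀ n, ContinuousOn (vn n) (Icc 0 T) := fun n =>
    ((continuous_exp_smul (Y.B n)).continuousOn.clm_apply continuousOn_const).add
      (continuousOn_duhamel hT hg)
  set K := M * (‖a₀ + f₀‖ + ∫ s in (0 : ℝ)..T, ‖g s‖) with hK
  have hbn : ∀ n, ∀ t ∈ Icc 0 T, ‖vn n t‖ ≤ K := by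
    intro n t ht
    have h1 : ∫ s in (0 : ℝ)..t, ‖g s‖ ≤ ∫ s in (0 : ℝ)..T, ‖g s‖ :=
      intervalIntegral.integral_mono_interval le_rfl ht.1 ht.2
        (.of_forall fun _ => norm_nonneg _) hg.norm
    rw [hK, mul_add]
    exact (norm_add_le _ _).trans (add_le_add (Y.norm_S_apply_le n ht _)
      ((Y.norm_duhamel_le n ht (hgt t ht)).trans (mul_le_mul_of_nonneg_left h1 hM)))
  refine ⟨v, ?_, fun t ht => ?_, fun t ht => ?_⟩
  · refine aestronglyMeasurable_of_tendsto_ae atTop (f := vn)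
      (fun n => (hcont n).aestronglyMeasurable measurableSet_Icc) ?_
    exact (ae_restrict_iff' measurableSet_Icc).2 (.of_forall fun t ht => hv t ht)
  · exact le_of_tendsto (hv t ht).norm (.of_forall fun n => hbn n t ht)
  · have hInt : Tendsto (fun n => ∫ s in (0 : ℝ)..t, vn n s) atTop
        (𝓝 (∫ s in (0 : ℝ)..t, v s)) := by
      have hsub : uIoc 0 t ⊆ Icc 0 T := by
        rw [uIoc_of_le ht.1]
        exact Ioc_subset_Icc_self.trans (Icc_subset_Icc_right ht.2)
      refine intervalIntegral.tendsto_integral_filter_of_dominated_convergence (fun _ => K)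
        (.of_forall fun n => ((hcont n).mono hsub).aestronglyMeasurable measurableSet_uIoc)
        (.of_forall fun n => .of_forall fun s hs => hbn n s (hsub hs))
        intervalIntegrable_const (.of_forall fun s hs => hv s (hsub hs))
    -- The vanishing correction makes `B n` send the initial value exactly to `a₀`, so `B n (un n)`
    -- is given by the integral equation for `vn n`.
    set un : ℕ → E := fun n => u₀ - (Y.lam n)⁻¹ • a₀ + ∫ s in (0 : ℝ)..t, vn n s with hun
    have hun_lim : Tendsto un atTop (𝓝 (u₀ + ∫ s in (0 : ℝ)..t, v s)) := by
      have h1 : Tendsto (fun n => u₀ - (Y.lam n)⁻¹ • a₀) atTop (𝓝 u₀) := by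
        simpa using (Y.tendsto_inv_lam.smul_const a₀).const_sub u₀
      exact h1.add hInt
    have hBun : ∀ n, Y.B n (un n) = vn n t - (f₀ + ∫ s in (0 : ℝ)..t, g s) := by
      intro n
      have h1 : Y.B n (u₀ - (Y.lam n)⁻¹ • a₀) = a₀ := by
        rw [map_sub, ContinuousLinearMap.map_smul_of_tower, Y.B_J_apply_sub,
          Y.B_apply_of_mem_graph n hu]
        abel
      have h2 : vn n t = _ := exp_add_duhamel_eq (B := Y.B n) (v₀ := a₀ + f₀) ht.1 (hgt t ht)
      simp only [hun]
      rw [map_add, h1, h2]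
      abel
    have hB_lim : Tendsto (fun n => Y.B n (un n)) atTop
        (𝓝 (v t - (f₀ + ∫ s in (0 : ℝ)..t, g s))) := by
      simp only [hBun]
      exact (hv t ht).sub_const _
    -- `J n` differs from the identity by `(lam n)⁻¹ • B n`, and `B n (un n)` converges. The pairs
    -- `(J n (un n), B n (un n))` lie on the closed graph of `A`.
    have hJ_lim : Tendsto (fun n => Y.J n (un n)) atTop (𝓝 (u₀ + ∫ s in (0 : ℝ)..t, v s)) := by
      have h1 := hun_lim.add (Y.tendsto_inv_lam.smul hB_lim)
      simp only [Y.B_J_apply_sub, add_sub_cancel, zero_smul, add_zero] at h1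
      exact h1
    exact hA.mem_of_tendsto (hJ_lim.prodMk_nhds hB_lim) (.of_forall fun n => Y.J_mem_graph n _)

/-- The a priori estimate for strict solutions. -/
theorem norm_strict_le (Y : YosidaSystem A T M) (hT : 0 < T) {w₀ : E} {g f : ℝ → E} (hg : IntervalIntegrable g volume 0 T)
    (hf : IntervalIntegrable f volume 0 T)
    (h : ∀ᵐ t ∂volume.restrict (Ioo 0 T), (w₀ + ∫ s in (0 : ℝ)..t, g s, g t - f t) ∈ A.graph)
    {t : ℝ} (ht : t ∈ Icc 0 T) :
    ‖w₀ + ∫ s in (0 : ℝ)..t, g s‖ ≤ M * M * (‖w₀‖ + ∫ s in (0 : ℝ)..T, ‖f s‖) := by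
  have hM := Y.nonneg
  set w : ℝ → E := fun t => w₀ + ∫ s in (0 : ℝ)..t, g s with hw
  have hwc : ContinuousOn w (Icc 0 T) :=
    continuousOn_const.add (IntervalIntegrable.continuousOn_primitive hT.le hg)
  have hgt := IntervalIntegrable.mono_right ht hg
  have hft := IntervalIntegrable.mono_right ht hf
  have hsub : ∀ᵐ s ∂volume.restrict (Ioc 0 t), (w s, g s - f s) ∈ A.graph := by
    rw [← restrict_Ioo_eq_restrict_Ioc]
    exact ae_mono (Measure.restrict_mono (Ioo_subset_Ioo_right ht.2) le_rfl) h
  -- The equation may fail at `t` itself, but it holds on a set of full measure, hence dense, and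
  -- `w` is continuous.
  have hcl : w t ∈ closure (A.domain : Set E) := by
    have hd : t ∈ closure ({s | (w s, g s - f s) ∈ A.graph} ∩ Ioo 0 T) := by
      refine mem_closure_iff.2 fun o ho hto => ?_
      have hne : (o ∩ Ioo 0 T).Nonempty := by
        rw [← closure_Ioo hT.ne] at ht
        exact mem_closure_iff.1 ht o ho hto
      have hpos : volume (o ∩ Ioo 0 T) ≠ 0 := ((ho.inter isOpen_Ioo).measure_pos _ hne).ne'
      rw [ae_restrict_iff' measurableSet_Ioo] at h
      by_contra hempty
      refine hpos (measure_mono_null (fun s hs => ?_) h)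
      intro hs'
      exact hempty ⟨s, hs.1, hs' hs.2, hs.2⟩
    have h1 := ((hwc t ht).mono (inter_subset_right.trans Ioo_subset_Icc_self)).mem_closure_image hd
    refine closure_mono ?_ h1
    rintro _ ⟨s, hs, rfl⟩
    exact LinearPMap.mem_domain_of_mem_graph hs.1
  have hJint : ∀ (m : ℕ) {k : ℝ → E}, IntervalIntegrable k volume 0 t →
      IntervalIntegrable (fun s => Y.J m (k s)) volume 0 t := fun m k hk =>
    intervalIntegrable_clm_apply continuous_const hk
  have hintle : ∫ s in (0 : ℝ)..t, ‖f s‖ ≤ ∫ s in (0 : ℝ)..T, ‖f s‖ :=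
    intervalIntegral.integral_mono_interval le_rfl ht.1 ht.2
      (.of_forall fun _ => norm_nonneg _) hf.norm
  refine le_of_tendsto (Y.tendsto_J_apply hcl).norm (.of_forall fun m => ?_)
  -- the remainder term for the Yosida approximation of index `n`
  set ρ : ℕ → ℝ → E := fun n s => Y.J n (Y.J m (g s - f s)) - Y.J m (g s - f s) with hρ
  have hρi : ∀ n, IntervalIntegrable (ρ n) volume 0 t := fun n =>
    (hJint n (hJint m (hgt.sub hft))).sub (hJint m (hgt.sub hft))
  -- `J m w` is treated as a solution for the generator `B n`; `ρ n` is the error of replacing `A`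
  -- by `B n`, since `B n (J m w) = J n (J m (g - f))`.
  have hJmw : ∀ n, Y.J m (w t) =
      Y.S n t (Y.J m w₀) + duhamel (Y.B n) (fun s => Y.J m (f s) - ρ n s) t := by
    intro n
    have h1 := eq_exp_add_duhamel (B := Y.B n) (w₀ := Y.J m w₀) ht.1 (hJint m hgt)
    have h2 : ∀ s ∈ Icc 0 t, Y.J m w₀ + ∫ r in (0 : ℝ)..s, Y.J m (g r) = Y.J m (w s) := by
      intro s hs
      rw [hw, map_add, ContinuousLinearMap.intervalIntegral_comp_comm _
        (IntervalIntegrable.mono_right hs hgt)]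
    rw [h2 t ⟨ht.1, le_rfl⟩] at h1
    rw [h1, S, duhamel, duhamel]
    congr 1
    refine intervalIntegral.integral_congr_ae ?_
    rw [uIoc_of_le ht.1]
    filter_upwards [(ae_restrict_iff' measurableSet_Ioc).1 hsub] with s hs hst
    have h3 := Y.B_apply_of_mem_graph n (hs hst)
    have h4 : Y.B n (Y.J m (w s)) = Y.J m (Y.B n (w s)) :=
      (DFunLike.congr_fun ((Y.commute_R_B m n).smul_left (Y.lam m)).eq (w s)).symm
    have h5 : Y.J m (Y.J n (g s - f s)) = Y.J n (Y.J m (g s - f s)) :=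
      DFunLike.congr_fun (((Y.commute_R_J m n).smul_left (Y.lam m))).eq _
    rw [h2 s (Ioc_subset_Icc_self hst), h4, h3, h5]
    simp only [hρ]
    congr 1
    rw [map_sub (Y.J m) (g s) (f s)]
    abel
  have hle : ∀ n, ‖Y.J m (w t)‖ ≤ M * (M * ‖w₀‖) + M * (∫ s in (0 : ℝ)..t, ‖Y.J m (f s)‖) +
      M * ∫ s in (0 : ℝ)..t, ‖ρ n s‖ := by
    intro n
    rw [hJmw n, duhamel_sub (hJint m hft) (hρi n), add_assoc]
    refine (norm_add_le _ _).trans (add_le_add ?_ ((norm_sub_le _ _).trans (add_le_add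
      (Y.norm_duhamel_le n ht (hJint m hft)) (Y.norm_duhamel_le n ht (hρi n)))))
    exact (Y.norm_S_apply_le n ht _).trans
      (mul_le_mul_of_nonneg_left (Y.norm_J_apply_le m _) hM)
  -- This is the purpose of regularizing by `J m`: its values lie in `D(A)`, where `J n` tends to
  -- the identity.
  have hlim : Tendsto (fun n => ∫ s in (0 : ℝ)..t, ‖ρ n s‖) atTop (𝓝 0) := by
    suffices hz : Tendsto (fun n => ∫ s in (0 : ℝ)..t, ‖ρ n s‖) atTop
        (𝓝 (∫ _ in (0 : ℝ)..t, (0 : ℝ))) by simpa using hz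
    refine intervalIntegral.tendsto_integral_filter_of_dominated_convergence
      (fun s => M * ‖Y.J m (g s - f s)‖ + ‖Y.J m (g s - f s)‖)
      (.of_forall fun n => (hρi n).norm.def'.aestronglyMeasurable)
      (.of_forall fun n => .of_forall fun s _ => ?_)
      (((hJint m (hgt.sub hft)).norm.const_mul M).add (hJint m (hgt.sub hft)).norm)
      (.of_forall fun s _ => ?_)
    · rw [norm_norm]
      exact (norm_sub_le _ _).trans (add_le_add_left (Y.norm_J_apply_le n _) _)
    · have h1 := (Y.tendsto_J_apply (subset_closure (Y.J_mem_domain m (g s - f s)))).sub_const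
        (Y.J m (g s - f s))
      rw [sub_self] at h1
      have h2 := h1.norm
      rwa [norm_zero] at h2
  have h1 : ‖Y.J m (w t)‖ ≤ M * (M * ‖w₀‖) + M * (∫ s in (0 : ℝ)..t, ‖Y.J m (f s)‖) + M * 0 :=
    ge_of_tendsto ((hlim.const_mul M).const_add _) (.of_forall hle)
  have h2 : ∫ s in (0 : ℝ)..t, ‖Y.J m (f s)‖ ≤ M * ∫ s in (0 : ℝ)..t, ‖f s‖ := by
    rw [← intervalIntegral.integral_const_mul]
    exact intervalIntegral.integral_mono_on ht.1 (hJint m hft).norm (hft.norm.const_mul M)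
      fun s _ => Y.norm_J_apply_le m _
  calc _ ≤ _ := h1
    _ ≤ M * (M * ‖w₀‖) + M * (M * ∫ s in (0 : ℝ)..T, ‖f s‖) + M * 0 := by
        gcongr
        exact h2.trans (mul_le_mul_of_nonneg_left hintle hM)
    _ = _ := by ring

end YosidaSystem

/-! ### The Cauchy problem for a single component in `W^{1,p}`. -/

section Scalar

variable {E : Type*} [NormedAddCommGroup E] {p : ℝ≥0∞} {T : ℝ}

instance (T : ℝ) : IsFiniteMeasure (intervalMeasure T) := by
  unfold intervalMeasure; infer_instance

theorem intervalMeasure_univ (T : ℝ) : intervalMeasure T univ = ENNReal.ofReal T := by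
  simp [intervalMeasure]

theorem ae_intervalMeasure_of_forall_Icc {P : ℝ → Prop} (h : ∀ t ∈ Icc 0 T, P t) :
    ∀ᵐ t ∂intervalMeasure T, P t :=
  (ae_restrict_iff' measurableSet_Ioo).2 (.of_forall fun t ht => h t (Ioo_subset_Icc_self ht))

theorem MemLp.intervalIntegrable {g : ℝ → E} (hp : 1 ≤ p) (hT : 0 ≤ T)
    (hg : MemLp g p (intervalMeasure T)) : IntervalIntegrable g volume 0 T :=
  (intervalIntegrable_iff_integrableOn_Ioo_of_le hT).2 (hg.integrable hp)

theorem ofReal_integral_norm_le (hp : 1 ≤ p) (hT : 0 < T) :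
    ∃ K : ℝ≥0∞, K ≠ ∞ ∧ ∀ g : ℝ → E, MemLp g p (intervalMeasure T) →
      ENNReal.ofReal (∫ t in (0 : ℝ)..T, ‖g t‖) ≤ K * eLpNorm g p (intervalMeasure T) := by
  refine ⟨intervalMeasure T univ ^ (1 / (1 : ℝ≥0∞).toReal - 1 / p.toReal), ?_, fun g hg => ?_⟩
  · rw [intervalMeasure_univ]
    exact ENNReal.rpow_ne_top_of_ne_zero (by simpa using hT) ENNReal.ofReal_ne_top
  · have h1 : ENNReal.ofReal (∫ t in (0 : ℝ)..T, ‖g t‖) = eLpNorm g 1 (intervalMeasure T) := by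
      rw [eLpNorm_one_eq_lintegral_enorm, ← ofReal_integral_norm_eq_lintegral_enorm
        (hg.integrable hp), intervalIntegral.integral_of_le hT.le, integral_Ioc_eq_integral_Ioo]
      rfl
    rw [h1, mul_comm]
    exact eLpNorm_le_eLpNorm_mul_rpow_measure_univ hp hg.aestronglyMeasurable

theorem eLpNorm_le_of_enorm_le {w : ℝ → E} {c : ℝ≥0∞} (hc : ∀ t ∈ Icc 0 T, ‖w t‖ₑ ≤ c) :
    eLpNorm w p (intervalMeasure T) ≤ intervalMeasure T univ ^ p.toReal⁻¹ * c := by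
  have h := eLpNorm_le_of_ae_enorm_bound (p := p) (ae_intervalMeasure_of_forall_Icc hc)
  rwa [smul_eq_mul, mul_comm] at h

variable [NormedSpace ℂ E]

theorem integral_congr_of_ae_eq {g k : ℝ → E} (h : g =ᵐ[intervalMeasure T] k) {t : ℝ}
    (ht : t ∈ Icc 0 T) : ∫ s in (0 : ℝ)..t, g s = ∫ s in (0 : ℝ)..t, k s := by
  rw [intervalIntegral.integral_of_le ht.1, intervalIntegral.integral_of_le ht.1,
    integral_Ioc_eq_integral_Ioo, integral_Ioc_eq_integral_Ioo]
  exact integral_congr_ae (ae_mono (Measure.restrict_mono (Ioo_subset_Ioo_right ht.2) le_rfl) h)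

theorem W1p.intervalIntegrable_der (hp : 1 ≤ p) (hT : 0 ≤ T) (w : W1p E p T) :
    IntervalIntegrable w.der volume 0 T :=
  MemLp.intervalIntegrable hp hT (Lp.memLp w.der)

theorem W1p.continuousOn (hp : 1 ≤ p) (hT : 0 ≤ T) (w : W1p E p T) : ContinuousOn w (Icc 0 T) :=
  continuousOn_const.add
    (IntervalIntegrable.continuousOn_primitive hT (w.intervalIntegrable_der hp hT))

theorem W1p.aestronglyMeasurable (hp : 1 ≤ p) (hT : 0 ≤ T) (w : W1p E p T) :
    AEStronglyMeasurable w (intervalMeasure T) :=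
  ((w.continuousOn hp hT).mono Ioo_subset_Icc_self).aestronglyMeasurable measurableSet_Ioo

theorem W1p.memLp (hp : 1 ≤ p) (hT : 0 ≤ T) (w : W1p E p T) : MemLp w p (intervalMeasure T) := by
  obtain ⟨c, hc⟩ := isCompact_Icc.exists_bound_of_continuousOn (w.continuousOn hp hT)
  exact MemLp.of_bound (w.aestronglyMeasurable hp hT) c (ae_intervalMeasure_of_forall_Icc hc)

/-- The element of `W^{1,p}` with given value at `0` and derivative. -/
def W1p.mk' (x : E) {g : ℝ → E} (hg : MemLp g p (intervalMeasure T)) : W1p E p T := ⟨x, hg.toLp g⟩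

theorem W1p.mk'_apply (x : E) {g : ℝ → E} (hg : MemLp g p (intervalMeasure T)) {t : ℝ}
    (ht : t ∈ Icc 0 T) : W1p.mk' x hg t = x + ∫ s in (0 : ℝ)..t, g s := by
  simp only [W1p.toFun, W1p.mk']
  rw [integral_congr_of_ae_eq hg.coeFn_toLp ht]

theorem W1p.apply_zero (w : W1p E p T) : w 0 = w.init := by simp [W1p.toFun]

theorem enorm_primitive_le (hp : 1 ≤ p) (hT : 0 < T) :
    ∃ K : ℝ≥0∞, K ≠ ∞ ∧ ∀ g : ℝ → E, MemLp g p (intervalMeasure T) → ∀ t ∈ Icc 0 T,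
      ‖∫ s in (0 : ℝ)..t, g s‖ₑ ≤ K * eLpNorm g p (intervalMeasure T) := by
  obtain ⟨K, hK, h⟩ := ofReal_integral_norm_le (E := E) hp hT
  refine ⟨K, hK, fun g hg t ht => le_trans ?_ (h g hg)⟩
  rw [← ofReal_norm]
  exact ENNReal.ofReal_le_ofReal (norm_primitive_le ht (MemLp.intervalIntegrable hp hT.le hg))

theorem rpow_intervalMeasure_univ_ne_top (p : ℝ≥0∞) (T : ℝ) :
    intervalMeasure T univ ^ p.toReal⁻¹ ≠ ∞ :=
  ENNReal.rpow_ne_top_of_nonneg (by positivity) (measure_ne_top _ _)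

theorem W1p.eLpNorm_le (hp : 1 ≤ p) (hT : 0 < T) :
    ∃ K : ℝ≥0∞, K ≠ ∞ ∧ ∀ w : W1p E p T, eLpNorm w p (intervalMeasure T) ≤
      K * (‖w.init‖ₑ + eLpNorm w.der p (intervalMeasure T)) := by
  obtain ⟨K, hK, h⟩ := enorm_primitive_le (E := E) hp hT
  refine ⟨intervalMeasure T univ ^ p.toReal⁻¹ * (1 + K), ENNReal.mul_ne_top
    (rpow_intervalMeasure_univ_ne_top p T) (by simpa using hK), fun w => ?_⟩
  rw [mul_assoc]
  refine eLpNorm_le_of_enorm_le fun t ht => ?_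
  refine (enorm_add_le _ _).trans ?_
  rw [add_mul, one_mul]
  refine add_le_add le_self_add ((h _ (Lp.memLp w.der) t ht).trans ?_)
  gcongr
  exact le_add_self

theorem eLpNorm_const_interval (hp : 1 ≤ p) (hT : 0 < T) (x : E) :
    eLpNorm (fun _ => x) p (intervalMeasure T) =
      ‖x‖ₑ * intervalMeasure T univ ^ p.toReal⁻¹ := by
  rw [eLpNorm_const _ (zero_lt_one.trans_le hp).ne', one_div]
  rw [Ne, ← Measure.measure_univ_eq_zero, intervalMeasure_univ]
  simpa using hT

theorem W1p.zero_apply {t : ℝ} (ht : t ∈ Icc 0 T) : (⟨0, 0⟩ : W1p E p T) t = 0 := by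
  simp only [W1p.toFun]
  rw [integral_congr_of_ae_eq (k := fun _ => (0 : E)) (Lp.coeFn_zero E p _) ht]
  simp

theorem rpow_intervalMeasure_univ_ne_zero (hT : 0 < T) (r : ℝ) :
    intervalMeasure T univ ^ r ≠ 0 := by
  rw [intervalMeasure_univ]
  exact (ENNReal.rpow_pos (by simpa using hT) ENNReal.ofReal_ne_top).ne'

/-- The constant function with value `w(0)` is `w` minus the primitive of its derivative; its `L^p`
norm is a positive multiple of `‖w(0)‖`. -/
theorem W1p.enorm_init_le (hp : 1 ≤ p) (hT : 0 < T) :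
    ∃ K : ℝ≥0∞, K ≠ ∞ ∧ ∀ w : W1p E p T, ‖w.init‖ₑ ≤
      K * (eLpNorm w p (intervalMeasure T) + eLpNorm w.der p (intervalMeasure T)) := by
  obtain ⟨K, hK, h⟩ := enorm_primitive_le (E := E) hp hT
  set κ := intervalMeasure T univ ^ p.toReal⁻¹ with hκ
  have hκt : κ ≠ ∞ := rpow_intervalMeasure_univ_ne_top p T
  have hκ0 : κ ≠ 0 := rpow_intervalMeasure_univ_ne_zero hT _
  refine ⟨κ⁻¹ * (1 + κ * K), ENNReal.mul_ne_top (ENNReal.inv_ne_top.2 hκ0)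
    (by simpa using ENNReal.mul_ne_top hκt hK), fun w => ?_⟩
  have hprim : AEStronglyMeasurable (fun t => ∫ s in (0 : ℝ)..t, w.der s) (intervalMeasure T) :=
    ((IntervalIntegrable.continuousOn_primitive hT.le (w.intervalIntegrable_der hp hT.le)).mono
      Ioo_subset_Icc_self).aestronglyMeasurable measurableSet_Ioo
  have h1 : eLpNorm (fun _ => w.init) p (intervalMeasure T) ≤
      eLpNorm w p (intervalMeasure T) + κ * (K * eLpNorm w.der p (intervalMeasure T)) := by
    have e : (fun _ : ℝ => w.init) = w.toFun - fun t => ∫ s in (0 : ℝ)..t, w.der s := by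
      funext t; simp [W1p.toFun]
    rw [e]
    exact (eLpNorm_sub_le (w.aestronglyMeasurable hp hT.le) hprim hp).trans
      (add_le_add le_rfl (eLpNorm_le_of_enorm_le (h _ (Lp.memLp w.der))))
  rw [eLpNorm_const_interval hp hT, mul_comm] at h1
  rw [mul_assoc, ← ENNReal.div_eq_inv_mul, ENNReal.le_div_iff_mul_le (.inl hκ0) (.inl hκt),
    mul_comm]
  refine h1.trans ?_
  rw [add_mul, one_mul, ← mul_assoc]
  refine add_le_add le_self_add ?_
  gcongr
  exact le_add_self

/-- The pointwise form of the equation `w' = A w + f`. -/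
def SolvesAE (A : E →ₗ.[ℂ] E) (f : ℝ → E) (w : W1p E p T) : Prop :=
  ∀ᵐ t ∂intervalMeasure T, (w t, w.der t - f t) ∈ A.graph

theorem mem_graph_sub_iff {A : E →ₗ.[ℂ] E} {x y z : E} :
    (x, y - z) ∈ A.graph ↔ ∃ hx : x ∈ A.domain, y = A ⟨x, hx⟩ + z := by
  constructor
  · intro h
    obtain ⟨w, hw, e⟩ := (LinearPMap.mem_graph_iff A).1 h
    simp only at hw e
    subst hw
    exact ⟨w.2, by rw [← sub_eq_iff_eq_add]; exact e.symm⟩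
  · rintro ⟨hx, rfl⟩
    rw [add_sub_cancel_right]
    exact A.mem_graph ⟨x, hx⟩

theorem solvesAE_iff {A : E →ₗ.[ℂ] E} {f : ℝ → E} {w : W1p E p T} : SolvesAE A f w ↔
    ∀ᵐ t ∂intervalMeasure T, ∃ ht : w t ∈ A.domain, w.der t = A ⟨w t, ht⟩ + f t := by
  simp only [SolvesAE, mem_graph_sub_iff]

theorem SolvesAE.congr {A : E →ₗ.[ℂ] E} {f k : ℝ → E} {w : W1p E p T} (hw : SolvesAE A f w)
    (hfk : f =ᵐ[intervalMeasure T] k) : SolvesAE A k w := by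
  filter_upwards [hw, hfk] with t h1 h2
  rwa [← h2]

theorem solvesAE_zero (A : E →ₗ.[ℂ] E) :
    SolvesAE A (0 : LpI E p T) (⟨0, 0⟩ : W1p E p T) := by
  filter_upwards [Lp.coeFn_zero E p (intervalMeasure T), ae_restrict_mem measurableSet_Ioo]
    with t h1 ht
  rw [W1p.zero_apply (Ioo_subset_Icc_self ht), sub_self]
  exact A.graph.zero_mem

variable [CompleteSpace E] {A : E →ₗ.[ℂ] E} {ω C : ℝ}

/-- The graph is a subspace, so the a priori bound applies to the difference of two solutions. `K`
precedes the data: one constant serves all components. -/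
theorem enorm_sub_le_of_solvesAE (hHY : HilleYosida A ω C) (hp : 1 ≤ p) (hT : 0 < T) :
    ∃ K : ℝ≥0∞, K ≠ ∞ ∧ ∀ (f k : ℝ → E) (w z : W1p E p T), MemLp f p (intervalMeasure T) →
      MemLp k p (intervalMeasure T) → SolvesAE A f w → SolvesAE A k z → ∀ t ∈ Icc 0 T,
      ‖w t - z t‖ₑ ≤ K * (‖w.init - z.init‖ₑ +
        eLpNorm (fun t => f t - k t) p (intervalMeasure T)) := by
  obtain ⟨M, ⟨Y⟩⟩ := hHY.exists_yosidaSystem T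
  have hM := Y.nonneg
  obtain ⟨K, hK, h⟩ := ofReal_integral_norm_le (E := E) hp hT
  refine ⟨ENNReal.ofReal (M * M) * (1 + K), ENNReal.mul_ne_top ENNReal.ofReal_ne_top
    (by simpa using hK), fun f k w z hf hk hw hz t ht => ?_⟩
  have hwi := w.intervalIntegrable_der hp hT.le
  have hzi := z.intervalIntegrable_der hp hT.le
  have heq : ∀ t ∈ Icc 0 T, (w.init - z.init) + ∫ s in (0 : ℝ)..t, (w.der s - z.der s) =
      w t - z t := fun t ht => by
    rw [intervalIntegral.integral_sub (IntervalIntegrable.mono_right ht hwi)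
      (IntervalIntegrable.mono_right ht hzi)]
    simp only [W1p.toFun]
    abel
  have h1 := Y.norm_strict_le hT (w₀ := w.init - z.init) (hwi.sub hzi)
    (MemLp.intervalIntegrable hp hT.le (hf.sub hk)) (by
      filter_upwards [hw, hz, ae_restrict_mem measurableSet_Ioo] with t h1 h2 ht
      rw [heq t (Ioo_subset_Icc_self ht)]
      have h3 := A.graph.sub_mem h1 h2
      rw [Prod.mk_sub_mk, sub_sub_sub_comm] at h3
      exact h3) ht
  rw [heq t ht] at h1
  have h2 := h _ (hf.sub hk)
  rw [← ofReal_norm]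
  refine (ENNReal.ofReal_le_ofReal h1).trans ?_
  rw [ENNReal.ofReal_mul (by positivity), ENNReal.ofReal_add (norm_nonneg _)
    (intervalIntegral.integral_nonneg hT.le fun _ _ => norm_nonneg _), ofReal_norm, mul_assoc]
  gcongr
  rw [add_mul, one_mul]
  refine add_le_add le_self_add (h2.trans ?_)
  gcongr
  exact le_add_self

/-- Existence of strict solutions in `W^{1,p}`. -/
theorem exists_solvesAE (hA : A.IsClosed) (hHY : HilleYosida A ω C) (hp : 1 ≤ p) (hT : 0 < T) :
    ∃ K : ℝ≥0∞, K ≠ ∞ ∧ ∀ (f : W1p E p T) (u₀ a₀ : E), (u₀, a₀) ∈ A.graph →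
      a₀ + f 0 ∈ closure (A.domain : Set E) → ∃ u : W1p E p T, u.init = u₀ ∧ SolvesAE A f u ∧
        eLpNorm u.der p (intervalMeasure T) ≤
          K * (‖a₀‖ₑ + (eLpNorm f p (intervalMeasure T) + eLpNorm f.der p (intervalMeasure T))) ∧
        eLpNorm u p (intervalMeasure T) ≤ K * (‖u₀‖ₑ + (‖a₀‖ₑ +
          (eLpNorm f p (intervalMeasure T) + eLpNorm f.der p (intervalMeasure T)))) := by
  obtain ⟨M, ⟨Y⟩⟩ := hHY.exists_yosidaSystem T
  have hM := Y.nonneg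
  obtain ⟨K, hK, h⟩ := ofReal_integral_norm_le (E := E) hp hT
  -- The bound on the derivative contains `f(0)`, which is controlled by the `W^{1,p}` norm of `f`.
  obtain ⟨K₁, hK₁, hinit⟩ := W1p.enorm_init_le (E := E) hp hT
  obtain ⟨K₂, hK₂, hW⟩ := W1p.eLpNorm_le (E := E) hp hT
  set κ := intervalMeasure T univ ^ p.toReal⁻¹ with hκ
  set K₃ := κ * (ENNReal.ofReal M * (1 + (K₁ + K))) with hK₃def
  have hK₃ : K₃ ≠ ∞ := ENNReal.mul_ne_top (rpow_intervalMeasure_univ_ne_top p T)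
    (ENNReal.mul_ne_top ENNReal.ofReal_ne_top (by simp [hK, hK₁]))
  refine ⟨K₃ + K₂ * (1 + K₃), by simp [hK₃, ENNReal.mul_eq_top, hK₂], fun f u₀ a₀ hu hcl => ?_⟩
  rw [W1p.apply_zero] at hcl
  have hfi := f.intervalIntegrable_der hp hT.le
  obtain ⟨v, hvm, hvb, hv⟩ := Y.exists_strict hA hT.le hfi hu hcl
  have hvm' : AEStronglyMeasurable v (intervalMeasure T) :=
    hvm.mono_measure (Measure.restrict_mono Ioo_subset_Icc_self le_rfl)
  have hvp : MemLp v p (intervalMeasure T) :=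
    MemLp.of_bound hvm' _ (ae_intervalMeasure_of_forall_Icc hvb)
  set c := ‖a₀‖ₑ + (eLpNorm f p (intervalMeasure T) + eLpNorm f.der p (intervalMeasure T))
    with hc
  have hder : eLpNorm (W1p.mk' u₀ hvp).der p (intervalMeasure T) ≤ K₃ * c := by
    have e : eLpNorm (W1p.mk' u₀ hvp).der p (intervalMeasure T) = eLpNorm v p (intervalMeasure T) :=
      eLpNorm_congr_ae hvp.coeFn_toLp
    rw [e, hK₃def, mul_assoc]
    refine eLpNorm_le_of_enorm_le fun t ht => ?_
    rw [← ofReal_norm]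
    refine (ENNReal.ofReal_le_ofReal (hvb t ht)).trans ?_
    rw [ENNReal.ofReal_mul hM, ENNReal.ofReal_add (norm_nonneg _)
      (intervalIntegral.integral_nonneg hT.le fun _ _ => norm_nonneg _), ofReal_norm, mul_assoc]
    gcongr
    have h2 : ‖f.init‖ₑ ≤ K₁ * c := (hinit f).trans (by gcongr; exact le_add_self)
    have h3 : ENNReal.ofReal (∫ s in (0 : ℝ)..T, ‖f.der s‖) ≤ K * c :=
      (h _ (Lp.memLp f.der)).trans (by gcongr; exact le_add_self.trans le_add_self)
    calc _ ≤ ‖a₀‖ₑ + ‖f.init‖ₑ + _ := by gcongr; exact enorm_add_le _ _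
      _ ≤ c + K₁ * c + K * c := by gcongr; exact le_self_add
      _ = _ := by ring
  refine ⟨W1p.mk' u₀ hvp, rfl, ?_, hder.trans (by gcongr; exact le_self_add), ?_⟩
  · filter_upwards [hvp.coeFn_toLp, ae_restrict_mem measurableSet_Ioo] with t h1 ht
    rw [W1p.mk'_apply u₀ hvp (Ioo_subset_Icc_self ht)]
    have h2 : (W1p.mk' u₀ hvp).der t = v t := h1
    rw [h2]
    exact hv t (Ioo_subset_Icc_self ht)
  · refine (hW _).trans ?_
    calc _ ≤ K₂ * (‖u₀‖ₑ + K₃ * c) := by gcongr; exact le_rfl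
      _ ≤ K₂ * ((1 + K₃) * (‖u₀‖ₑ + c)) := by
          gcongr
          rw [add_mul, one_mul]
          gcongr <;> simp
      _ ≤ _ := by rw [← mul_assoc]; gcongr; exact le_add_self

/-- The data of strict solutions are dense. -/
theorem exists_solvesAE_approx (hA : A.IsClosed) (hHY : HilleYosida A ω C) (hp : 1 ≤ p)
    (hp' : p ≠ ∞) (hT : 0 < T) {f : ℝ → E} (hf : MemLp f p (intervalMeasure T)) {u₀ : E}
    (hu : u₀ ∈ closure (A.domain : Set E)) {ε : ℝ≥0∞} (hε : ε ≠ 0) :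
    ∃ (w k : W1p E p T), SolvesAE A k w ∧ ‖w.init - u₀‖ₑ ≤ ε ∧
      eLpNorm (fun t => k t - f t) p (intervalMeasure T) ≤ ε := by
  wlog hεt : ε ≠ ∞ generalizing ε
  · obtain ⟨w, k, h1, h2, h3⟩ := this one_ne_zero ENNReal.one_ne_top
    rw [not_ne_iff.1 hεt]
    exact ⟨w, k, h1, le_top, le_top⟩
  obtain ⟨M, ⟨Y⟩⟩ := hHY.exists_yosidaSystem T
  have hr : 0 < ε.toReal := ENNReal.toReal_pos hε hεt
  have : IsFiniteMeasureOnCompacts (intervalMeasure T) := inferInstance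
  obtain ⟨k, -, hk, hkε⟩ := hf.exist_eLpNorm_sub_le hp' hp hr
  have hk1 : ContDiff ℝ 1 k := hk.of_le (by exact_mod_cast le_top)
  have hk' : Continuous (deriv k) := hk1.continuous_deriv le_rfl
  have hkp : MemLp (deriv k) p (intervalMeasure T) := by
    obtain ⟨c, hc⟩ := isCompact_Icc.exists_bound_of_continuousOn (s := Icc 0 T) hk'.continuousOn
    exact MemLp.of_bound hk'.aestronglyMeasurable c (ae_intervalMeasure_of_forall_Icc hc)
  set F : W1p E p T := W1p.mk' (k 0) hkp with hF
  have hFk : ∀ t ∈ Icc 0 T, F t = k t := fun t ht => by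
    rw [W1p.mk'_apply _ _ ht, intervalIntegral.integral_deriv_eq_sub
      (fun r _ => (hk1.differentiable one_ne_zero).differentiableAt) (hk'.intervalIntegrable 0 t)]
    abel
  obtain ⟨y', hy', hy'u⟩ := Metric.mem_closure_iff.1 hu (ε.toReal / 3) (by positivity)
  obtain ⟨z, hz⟩ := LinearPMap.mem_domain_iff.1 hy'
  obtain ⟨m, hm⟩ := ((Metric.tendsto_nhds.1 (Y.tendsto_J_apply (subset_closure hy'))
    (ε.toReal / 3) (by positivity))).exists
  obtain ⟨n, hn⟩ := ((Metric.tendsto_nhds.1 (Y.tendsto_R_apply (k 0))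
    (ε.toReal / 3) (by positivity))).exists
  -- The initial value is `J m y' + R n (k 0)`. The second, small term repairs compatibility: `A`
  -- maps it to `J n (k 0) - k 0`, so adding `k 0` leaves `J m (A y') + J n (k 0)`, which is in
  -- `D(A)`.
  have hgr := A.graph.add_mem (Y.J_mem_graph m y') (Y.R_mem_graph n (k 0))
  rw [Prod.mk_add_mk] at hgr
  obtain ⟨K, -, hex⟩ := exists_solvesAE (E := E) (p := p) hA hHY hp hT
  obtain ⟨w, hw0, hw, -⟩ := hex F _ _ hgr (by
    rw [hFk 0 ⟨le_rfl, hT.le⟩, add_assoc, sub_add_cancel, Y.B_apply_of_mem_graph m hz]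
    exact subset_closure (A.domain.add_mem (Y.J_mem_domain m z) (Y.J_mem_domain n _)))
  refine ⟨w, F, hw, ?_, ?_⟩
  · rw [hw0, ← ofReal_norm]
    refine (ENNReal.ofReal_le_iff_le_toReal hεt).2 ?_
    rw [dist_eq_norm] at hy'u hm hn
    rw [sub_zero] at hn
    have e : Y.J m y' + Y.R n (k 0) - u₀ = (Y.J m y' - y') + Y.R n (k 0) - (u₀ - y') := by abel
    rw [e]
    have h1 := norm_sub_le ((Y.J m y' - y') + Y.R n (k 0)) (u₀ - y')
    have h2 := norm_add_le (Y.J m y' - y') (Y.R n (k 0))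
    linarith
  · rw [ENNReal.ofReal_toReal hεt, eLpNorm_sub_comm] at hkε
    refine le_of_eq_of_le (eLpNorm_congr_ae ?_) hkε
    exact ae_intervalMeasure_of_forall_Icc fun t ht => by simp [hFk t ht]

/-- `U` is a limit of strict solutions whose data converge to `f`, `u₀`. -/
def IsLimitSolution (A : E →ₗ.[ℂ] E) (f : ℝ → E) (u₀ : E) (U : LpI E p T) : Prop :=
  ∀ ε : ℝ≥0∞, ε ≠ 0 → ∃ (w k : W1p E p T), SolvesAE A k w ∧
    ‖w.init - u₀‖ₑ ≤ ε ∧ eLpNorm (fun t => k t - f t) p (intervalMeasure T) ≤ ε ∧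
    eLpNorm (fun t => w t - U t) p (intervalMeasure T) ≤ ε

/-- Limits of strict solutions whose data converge. -/
theorem exists_limit_solution (hA : A.IsClosed) (hHY : HilleYosida A ω C) (hp : 1 ≤ p)
    (hp' : p ≠ ∞) (hT : 0 < T) {f : ℝ → E} (hf : MemLp f p (intervalMeasure T)) {u₀ : E}
    (hu : u₀ ∈ closure (A.domain : Set E)) :
    ∃ U : LpI E p T, IsLimitSolution A f u₀ U := by
  have : Fact (1 ≤ p) := ⟨hp⟩
  obtain ⟨K, hK, hest⟩ := enorm_sub_le_of_solvesAE (p := p) hHY hp hT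
  set e : ℕ → ℝ≥0∞ := fun n => ((n : ℝ≥0∞) + 1)⁻¹ with he
  have he0 : ∀ n, e n ≠ 0 := fun n => ENNReal.inv_ne_zero.2 (by finiteness)
  have helim : Tendsto e atTop (𝓝 0) := by
    have h1 := (tendsto_add_atTop_iff_nat 1).2 ENNReal.tendsto_inv_nat_nhds_zero
    simpa using h1
  have hemono : ∀ m n, m ≤ n → e n ≤ e m := fun m n h => by
    simp only [he]
    gcongr
  choose w k hwk hinit hdata using fun n =>
    exists_solvesAE_approx hA hHY hp hp' hT hf hu (he0 n)
  set κ := intervalMeasure T univ ^ p.toReal⁻¹ with hκ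
  have hκt : κ ≠ ∞ := rpow_intervalMeasure_univ_ne_top p T
  -- Stability turns closeness of the data into closeness of the strict solutions.
  have hdist : ∀ m n, eLpNorm (fun t => w m t - w n t) p (intervalMeasure T) ≤
      κ * (K * ((e m + e n) + (e m + e n))) := by
    intro m n
    refine eLpNorm_le_of_enorm_le fun t ht => ?_
    refine (hest _ _ _ _ ((k m).memLp hp hT.le) ((k n).memLp hp hT.le) (hwk m) (hwk n) t ht).trans ?_
    gcongr
    · have h1 : (w m).init - (w n).init = ((w m).init - u₀) - ((w n).init - u₀) := by abel
      rw [h1]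
      exact (enorm_sub_le).trans (add_le_add (hinit m) (hinit n))
    · have h1 : (fun t => k m t - k n t) = (fun t => k m t - f t) - fun t => k n t - f t := by
        funext t; simp
      rw [h1]
      exact (eLpNorm_sub_le (((k m).memLp hp hT.le).sub hf).aestronglyMeasurable
        (((k n).memLp hp hT.le).sub hf).aestronglyMeasurable hp).trans
        (add_le_add (hdata m) (hdata n))
  set W : ℕ → LpI E p T := fun n => ((w n).memLp hp hT.le).toLp (w n) with hW
  have hCauchy : CauchySeq W := by
    refine EMetric.cauchySeq_iff_le_tendsto_0.2 ⟨fun N => κ * (K * ((e N + e N) + (e N + e N))),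
      fun m n N hm hn => ?_, ?_⟩
    · rw [Lp.edist_toLp_toLp]
      refine (hdist m n).trans ?_
      beta_reduce
      gcongr <;> exact hemono _ _ (by assumption)
    · have h1 : Tendsto (fun N => (e N + e N) + (e N + e N)) atTop (𝓝 0) := by
        simpa using (helim.add helim).add (helim.add helim)
      have h2 := ENNReal.Tendsto.const_mul (a := κ)
        (ENNReal.Tendsto.const_mul (a := K) h1 (.inr hK)) (.inr hκt)
      simpa using h2
  obtain ⟨U, hU⟩ := cauchySeq_tendsto_of_complete hCauchy
  have hU' : Tendsto (fun n => eLpNorm (fun t => w n t - U t) p (intervalMeasure T)) atTop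
      (𝓝 0) := by
    have h1 := (tendsto_iff_edist_tendsto_0).1 hU
    refine h1.congr fun n => ?_
    rw [Lp.edist_def]
    refine eLpNorm_congr_ae ?_
    filter_upwards [((w n).memLp hp hT.le).coeFn_toLp] with t ht
    simp [hW, ht]
  refine ⟨U, fun ε hε => ?_⟩
  have hε' : (0 : ℝ≥0∞) < ε := pos_iff_ne_zero.2 hε
  obtain ⟨n, h1, h2⟩ := ((hU'.eventually (gt_mem_nhds hε')).and
    (helim.eventually (gt_mem_nhds hε'))).exists
  exact ⟨w n, k n, hwk n, (hinit n).trans h2.le, (hdata n).trans h2.le, h1.le⟩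

theorem eLpNorm_sub_le_of_solvesAE (hHY : HilleYosida A ω C) (hp : 1 ≤ p) (hT : 0 < T) :
    ∃ K : ℝ≥0∞, K ≠ ∞ ∧ ∀ (f k : ℝ → E) (w z : W1p E p T), MemLp f p (intervalMeasure T) →
      MemLp k p (intervalMeasure T) → SolvesAE A f w → SolvesAE A k z →
      eLpNorm (fun t => w t - z t) p (intervalMeasure T) ≤ K * (‖w.init - z.init‖ₑ +
        eLpNorm (fun t => f t - k t) p (intervalMeasure T)) := by
  obtain ⟨K, hK, h⟩ := enorm_sub_le_of_solvesAE (p := p) hHY hp hT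
  refine ⟨_, ENNReal.mul_ne_top (rpow_intervalMeasure_univ_ne_top p T) hK,
    fun f k w z hf hk hw hz => ?_⟩
  rw [mul_assoc]
  exact eLpNorm_le_of_enorm_le (h f k w z hf hk hw hz)

/-- Approximants are compared with the zero solution and the tolerance tends to zero. The uniform
`K` places the sequence of limits in the weighted space. -/
theorem IsLimitSolution.eLpNorm_le (hHY : HilleYosida A ω C) (hp : 1 ≤ p) (hT : 0 < T) :
    ∃ K : ℝ≥0∞, K ≠ ∞ ∧ ∀ (f : ℝ → E) (u₀ : E) (U : LpI E p T), MemLp f p (intervalMeasure T) →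
      IsLimitSolution A f u₀ U → eLpNorm U p (intervalMeasure T) ≤
        K * (‖u₀‖ₑ + eLpNorm f p (intervalMeasure T)) := by
  obtain ⟨K, hK, h⟩ := eLpNorm_sub_le_of_solvesAE (p := p) hHY hp hT
  refine ⟨K, hK, fun f u₀ U hf hU => ?_⟩
  have key : ∀ ε : ℝ≥0∞, ε ≠ 0 → eLpNorm U p (intervalMeasure T) ≤
      K * ((‖u₀‖ₑ + ε) + (eLpNorm f p (intervalMeasure T) + ε)) + ε := by
    intro ε hε
    obtain ⟨w, k, hw, h1, h2, h3⟩ := hU ε hε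
    have hwm := w.memLp hp hT.le
    have hkm := k.memLp hp hT.le
    have h4 := h k (0 : LpI E p T) w ⟨0, 0⟩ hkm (Lp.memLp _) hw (solvesAE_zero A)
    have e1 : eLpNorm (fun t => w t - (⟨0, 0⟩ : W1p E p T) t) p (intervalMeasure T) =
        eLpNorm w p (intervalMeasure T) :=
      eLpNorm_congr_ae (ae_intervalMeasure_of_forall_Icc fun t ht => by
        beta_reduce
        rw [W1p.zero_apply ht, sub_zero])
    have e2 : eLpNorm (fun t => k t - (0 : LpI E p T) t) p (intervalMeasure T) =
        eLpNorm k p (intervalMeasure T) := by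
      refine eLpNorm_congr_ae ?_
      filter_upwards [Lp.coeFn_zero E p (intervalMeasure T)] with t ht
      rw [ht, Pi.zero_apply, sub_zero]
    rw [e1, e2, sub_zero] at h4
    have h5 : eLpNorm k p (intervalMeasure T) ≤ eLpNorm f p (intervalMeasure T) + ε := by
      have e : k.toFun = f + fun t => k t - f t := by funext t; simp
      rw [e]
      exact (eLpNorm_add_le hf.aestronglyMeasurable (hkm.sub hf).aestronglyMeasurable hp).trans
        (add_le_add le_rfl h2)
    have h6 : ‖w.init‖ₑ ≤ ‖u₀‖ₑ + ε := by
      have e : w.init = u₀ + (w.init - u₀) := by abel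
      rw [e]
      exact (enorm_add_le _ _).trans (add_le_add le_rfl h1)
    have e : (U : ℝ → E) = w.toFun - fun t => w t - U t := by funext t; simp
    rw [e]
    refine (eLpNorm_sub_le hwm.aestronglyMeasurable
      (hwm.sub (Lp.memLp U)).aestronglyMeasurable hp).trans (add_le_add (h4.trans ?_) h3)
    gcongr
  have hlim : Tendsto (fun ε : ℝ≥0∞ =>
      K * ((‖u₀‖ₑ + ε) + (eLpNorm f p (intervalMeasure T) + ε)) + ε) (𝓝 0)
      (𝓝 (K * (‖u₀‖ₑ + eLpNorm f p (intervalMeasure T)))) := by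
    have h1 : Tendsto (fun ε : ℝ≥0∞ => (‖u₀‖ₑ + ε) + (eLpNorm f p (intervalMeasure T) + ε)) (𝓝 0)
        (𝓝 (‖u₀‖ₑ + 0 + (eLpNorm f p (intervalMeasure T) + 0))) :=
      (tendsto_const_nhds.add tendsto_id).add (tendsto_const_nhds.add tendsto_id)
    have h2 := (ENNReal.Tendsto.const_mul (a := K) h1 (.inr hK)).add tendsto_id
    simpa using h2
  have hseq : Tendsto (fun n : ℕ => ((n : ℝ≥0∞))⁻¹) atTop (𝓝 0) :=
    ENNReal.tendsto_inv_nat_nhds_zero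
  exact ge_of_tendsto (hlim.comp hseq) (.of_forall fun n => key _ (by simp))

end Scalar

/-! ### Weighted sums and truncation. -/

section Weights

variable {p q : ℝ≥0∞} {s h T : ℝ}

theorem one_le_toReal (hp : 1 ≤ p) (hp' : p ≠ ∞) : 1 ≤ p.toReal := by
  simpa using ENNReal.toReal_mono hp' hp

theorem weight_pos (hh : 0 < h) (α : ℕ) : 0 < weight p s h α := by
  unfold weight
  have : (0 : ℝ) < Nat.factorial α := by exact_mod_cast Nat.factorial_pos α
  positivity

/-- The weighted sum `∑_α α!^{ps} / h^{pα} a_α^p`. -/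
def wsum (p : ℝ≥0∞) (s h : ℝ) (a : ℕ → ℝ≥0∞) : ℝ≥0∞ :=
  ∑' α, ENNReal.ofReal (weight p s h α) * a α ^ p.toReal

theorem term_le_wsum (a : ℕ → ℝ≥0∞) (α : ℕ) :
    ENNReal.ofReal (weight p s h α) * a α ^ p.toReal ≤ wsum p s h a :=
  ENNReal.le_tsum α

theorem wsum_mono {a b : ℕ → ℝ≥0∞} (hab : ∀ α, a α ≤ b α) : wsum p s h a ≤ wsum p s h b :=
  ENNReal.tsum_le_tsum fun α => by gcongr; exact hab α

theorem wsum_const_mul (a : ℕ → ℝ≥0∞) (c : ℝ≥0∞) :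
    wsum p s h (fun α => c * a α) = c ^ p.toReal * wsum p s h a := by
  rw [wsum, wsum, ← ENNReal.tsum_mul_left]
  refine tsum_congr fun α => ?_
  rw [ENNReal.mul_rpow_of_nonneg _ _ ENNReal.toReal_nonneg]
  ring

theorem wsum_const_mul_lt_top {a : ℕ → ℝ≥0∞} {c : ℝ≥0∞} (hc : c ≠ ∞)
    (ha : wsum p s h a < ∞) : wsum p s h (fun α => c * a α) < ∞ := by
  rw [wsum_const_mul]
  exact ENNReal.mul_lt_top (ENNReal.rpow_lt_top_of_nonneg ENNReal.toReal_nonneg hc) ha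

theorem wsum_add_lt_top (hp : 1 ≤ p) (hp' : p ≠ ∞) {a b : ℕ → ℝ≥0∞} (ha : wsum p s h a < ∞)
    (hb : wsum p s h b < ∞) : wsum p s h (fun α => a α + b α) < ∞ := by
  have h1 : wsum p s h (fun α => a α + b α) ≤
      2 ^ (p.toReal - 1) * (wsum p s h a + wsum p s h b) := by
    rw [wsum, wsum, wsum, ← ENNReal.tsum_add, ← ENNReal.tsum_mul_left]
    refine ENNReal.tsum_le_tsum fun α => ?_
    calc _ ≤ ENNReal.ofReal (weight p s h α) *
          (2 ^ (p.toReal - 1) * (a α ^ p.toReal + b α ^ p.toReal)) := by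
          gcongr
          exact ENNReal.rpow_add_le_mul_rpow_add_rpow _ _ (one_le_toReal hp hp')
      _ = _ := by ring
  refine h1.trans_lt (ENNReal.mul_lt_top (ENNReal.rpow_lt_top_of_nonneg ?_ (by simp))
    (ENNReal.add_lt_top.2 ⟨ha, hb⟩))
  linarith [one_le_toReal hp hp']

theorem wsum_lt_top_of_finite (hp : 1 ≤ p) (hp' : p ≠ ∞) {a : ℕ → ℝ≥0∞} (k : ℕ)
    (ha : ∀ α, a α ≠ ∞) (h0 : ∀ α, k ≤ α → a α = 0) : wsum p s h a < ∞ := by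
  have hP := one_le_toReal hp hp'
  rw [wsum, tsum_eq_sum (s := Finset.range k)]
  · refine ENNReal.sum_lt_top.2 fun α _ => ENNReal.mul_lt_top ENNReal.ofReal_lt_top
      (ENNReal.rpow_lt_top_of_nonneg ENNReal.toReal_nonneg (ha α))
  · intro α hα
    rw [h0 α (by simpa using hα), ENNReal.zero_rpow_of_pos (by linarith), mul_zero]

theorem seqNorm_eq {X : Type*} [NormedAddCommGroup X] (F : ℕ → ℝ → X) :
    seqNorm p s h T F =
      wsum p s h (fun α => eLpNorm (F α) p (intervalMeasure T)) ^ (1 / p.toReal) := rfl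

theorem seqNorm_lt_top_iff {X : Type*} [NormedAddCommGroup X] (hp : 1 ≤ p) (hp' : p ≠ ∞)
    {F : ℕ → ℝ → X} : seqNorm p s h T F < ∞ ↔
      wsum p s h (fun α => eLpNorm (F α) p (intervalMeasure T)) < ∞ := by
  have hP := one_le_toReal hp hp'
  rw [seqNorm_eq, ENNReal.rpow_lt_top_iff_of_pos (by positivity)]

theorem tendsto_seqNorm_iff {X : Type*} [NormedAddCommGroup X] (hp : 1 ≤ p) (hp' : p ≠ ∞)
    {F : ℕ → ℕ → ℝ → X} : Tendsto (fun k => seqNorm p s h T (F k)) atTop (𝓝 0) ↔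
      Tendsto (fun k => wsum p s h (fun α => eLpNorm (F k α) p (intervalMeasure T))) atTop
        (𝓝 0) := by
  have hP := one_le_toReal hp hp'
  have hP0 : 0 < p.toReal := by linarith
  constructor
  · intro H
    have h1 := (ENNReal.continuous_rpow_const (y := p.toReal)).tendsto 0 |>.comp H
    rw [ENNReal.zero_rpow_of_pos hP0] at h1
    refine h1.congr fun k => ?_
    simp only [Function.comp, seqNorm_eq]
    rw [← ENNReal.rpow_mul, one_div_mul_cancel hP0.ne', ENNReal.rpow_one]
  · intro H
    have h1 := (ENNReal.continuous_rpow_const (y := 1 / p.toReal)).tendsto 0 |>.comp H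
    rwa [ENNReal.zero_rpow_of_pos (by positivity)] at h1

/-- Convergence in the weighted sum implies convergence of each component. -/
theorem tendsto_of_tendsto_wsum (hp : 1 ≤ p) (hp' : p ≠ ∞) (hh : 0 < h) {a : ℕ → ℕ → ℝ≥0∞}
    (H : Tendsto (fun k => wsum p s h (a k)) atTop (𝓝 0)) (α : ℕ) :
    Tendsto (fun k => a k α) atTop (𝓝 0) := by
  have hP := one_le_toReal hp hp'
  have hP0 : 0 < p.toReal := by linarith
  set c := ENNReal.ofReal (weight p s h α) with hc
  have hc0 : c ≠ 0 := by simpa [hc] using weight_pos hh α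
  have hct : c ≠ ∞ := ENNReal.ofReal_ne_top
  have h1 : Tendsto (fun k => c⁻¹ * wsum p s h (a k)) atTop (𝓝 0) := by
    simpa using ENNReal.Tendsto.const_mul H (.inr (ENNReal.inv_ne_top.2 hc0))
  have h2 : Tendsto (fun k => a k α ^ p.toReal) atTop (𝓝 0) := by
    refine tendsto_of_tendsto_of_tendsto_of_le_of_le tendsto_const_nhds h1
      (fun _ => zero_le) fun k => ?_
    have := term_le_wsum (p := p) (s := s) (h := h) (a k) α
    calc a k α ^ p.toReal = c⁻¹ * (c * a k α ^ p.toReal) := by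
          rw [← mul_assoc, ENNReal.inv_mul_cancel hc0 hct, one_mul]
      _ ≤ _ := by gcongr
  have h3 := (ENNReal.continuous_rpow_const (y := p.toReal⁻¹)).tendsto 0 |>.comp h2
  rw [ENNReal.zero_rpow_of_pos (by positivity)] at h3
  refine h3.congr fun k => ?_
  simp only [Function.comp]
  rw [← ENNReal.rpow_mul, mul_inv_cancel₀ hP0.ne', ENNReal.rpow_one]

/-- A tolerance for the first `k` components that is negligible in the weighted sum. -/
def truncTol (p : ℝ≥0∞) (s h : ℝ) (k : ℕ) : ℝ≥0∞ :=
  ((k + 1) * (1 + ∑ α ∈ Finset.range k, ENNReal.ofReal (weight p s h α)))⁻¹ ^ p.toReal⁻¹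

theorem truncTol_ne_zero (p : ℝ≥0∞) (s h : ℝ) (k : ℕ) : truncTol p s h k ≠ 0 := by
  have h1 : ((k : ℝ≥0∞) + 1) * (1 + ∑ α ∈ Finset.range k, ENNReal.ofReal (weight p s h α)) ≠ ∞ :=
    ENNReal.mul_ne_top (by finiteness) (by simp [ENNReal.sum_eq_top])
  have h2 := ENNReal.inv_ne_zero.2 h1
  intro h3
  rcases ENNReal.rpow_eq_zero_iff.1 h3 with h4 | h4
  · exact h2 h4.1
  · have : 0 ≤ p.toReal⁻¹ := by positivity
    linarith [h4.2]

theorem sum_truncTol_le (hp : 1 ≤ p) (hp' : p ≠ ∞) {b : ℕ → ℝ≥0∞} {k : ℕ}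
    (hb : ∀ α, α < k → b α ≤ truncTol p s h k) :
    ∑ α ∈ Finset.range k, ENNReal.ofReal (weight p s h α) * b α ^ p.toReal ≤
      ((k : ℝ≥0∞) + 1)⁻¹ := by
  have hP := one_le_toReal hp hp'
  have hP0 : 0 < p.toReal := by linarith
  have h1 : ∑ α ∈ Finset.range k, ENNReal.ofReal (weight p s h α) * b α ^ p.toReal ≤
      ∑ α ∈ Finset.range k, ENNReal.ofReal (weight p s h α) * truncTol p s h k ^ p.toReal :=
    Finset.sum_le_sum fun α hα =>
      mul_le_mul_right (ENNReal.rpow_le_rpow (hb α (Finset.mem_range.1 hα)) hP0.le) _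
  refine h1.trans ?_
  -- With `c` the sum of the first `k` weights, the `p`-th power of the tolerance is `1 / ((k + 1)
  -- (1 + c))`; the summand `1` keeps the second factor away from zero.
  rw [← Finset.sum_mul, truncTol, ← ENNReal.rpow_mul, inv_mul_cancel₀ hP0.ne', ENNReal.rpow_one]
  have hct : ∑ α ∈ Finset.range k, ENNReal.ofReal (weight p s h α) ≠ ∞ := by
    simp [ENNReal.sum_eq_top]
  generalize ∑ α ∈ Finset.range k, ENNReal.ofReal (weight p s h α) = c at hct
  calc c * ((k + 1) * (1 + c))⁻¹ ≤ (1 + c) * ((k + 1) * (1 + c))⁻¹ :=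
        mul_le_mul_left le_add_self _
    _ = _ := by
        rw [ENNReal.mul_inv (.inr (by simp [hct])) (.inr (by simp)), mul_left_comm,
          ENNReal.mul_inv_cancel (by simp) (by simp [hct]), mul_one]

/-- The first `k` terms contribute at most `1 / (k + 1)` and the others at most the tail of a
convergent series. -/
theorem tendsto_wsum_trunc (hp : 1 ≤ p) (hp' : p ≠ ∞) {a : ℕ → ℝ≥0∞} {b : ℕ → ℕ → ℝ≥0∞}
    (ha : wsum p s h a < ∞) (h1 : ∀ k α, α < k → b k α ≤ truncTol p s h k)
    (h2 : ∀ k α, k ≤ α → b k α ≤ a α) : Tendsto (fun k => wsum p s h (b k)) atTop (𝓝 0) := by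
  have hP := one_le_toReal hp hp'
  have hP0 : 0 < p.toReal := by linarith
  have htail : Tendsto (fun k => ∑' α, ENNReal.ofReal (weight p s h (α + k)) *
      a (α + k) ^ p.toReal) atTop (𝓝 0) :=
    ENNReal.tendsto_sum_nat_add (fun α => ENNReal.ofReal (weight p s h α) * a α ^ p.toReal) ha.ne
  have hhead : Tendsto (fun k : ℕ => ((k : ℝ≥0∞) + 1)⁻¹) atTop (𝓝 0) := by
    have h1 := (tendsto_add_atTop_iff_nat 1).2 ENNReal.tendsto_inv_nat_nhds_zero
    simpa using h1
  have hsum := hhead.add htail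
  rw [add_zero] at hsum
  have hle : ∀ k, wsum p s h (b k) ≤ ((k : ℝ≥0∞) + 1)⁻¹ +
      ∑' α, ENNReal.ofReal (weight p s h (α + k)) * a (α + k) ^ p.toReal := by
    intro k
    have hsplit := Summable.sum_add_tsum_nat_add' (k := k) (f := fun α =>
      ENNReal.ofReal (weight p s h α) * b k α ^ p.toReal) ENNReal.summable
    rw [wsum, ← hsplit]
    refine add_le_add (sum_truncTol_le hp hp' fun α hα => h1 k α hα)
      (ENNReal.tsum_le_tsum fun α => ?_)
    have h3 : b k (α + k) ≤ a (α + k) := h2 k (α + k) (Nat.le_add_left k α)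
    exact mul_le_mul_right (ENNReal.rpow_le_rpow h3 hP0.le) _
  exact tendsto_of_tendsto_of_tendsto_of_le_of_le tendsto_const_nhds hsum (fun _ => zero_le) hle

theorem WeightedSummable.wsum_lt_top {X : Type*} [NormedAddCommGroup X] (hh : 0 < h)
    {x : ℕ → X} (hx : WeightedSummable p s h x) : wsum p s h (fun α => ‖x α‖ₑ) < ∞ := by
  have h1 := hx.tsum_ofReal_lt_top
  refine lt_of_eq_of_lt (tsum_congr fun α => ?_) h1
  beta_reduce
  rw [ENNReal.ofReal_mul (weight_pos hh α).le, ← ofReal_norm,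
    ENNReal.ofReal_rpow_of_nonneg (norm_nonneg _) ENNReal.toReal_nonneg]

theorem seqSobolevNorm_lt_top_iff {E : Type*} [NormedAddCommGroup E] [NormedSpace ℂ E]
    (hp : 1 ≤ p) (hp' : p ≠ ∞) {F : ℕ → W1p E p T} : F ∈ SeqW1p E p s h T ↔
      wsum p s h (fun α => eLpNorm (F α) p (intervalMeasure T)) < ∞ ∧
        wsum p s h (fun α => eLpNorm (F α).der p (intervalMeasure T)) < ∞ := by
  have hP := one_le_toReal hp hp'
  change seqSobolevNorm p s h T F < ∞ ↔ _
  rw [seqSobolevNorm, ENNReal.rpow_lt_top_iff_of_pos (by positivity), ← ENNReal.add_lt_top]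
  simp only [mul_add]
  rw [ENNReal.tsum_add]
  rfl

end Weights

/-! ### Continuity of the pairing with test functions. -/

section Pairing

variable {p q : ℝ≥0∞} {s h T : ℝ}

theorem holderConjugate_toReal (hp' : p ≠ ∞) (hp1 : 1 ≤ p) (hq : q ≠ ∞)
    (hpq : p⁻¹ + q⁻¹ = 1) : q.toReal.HolderConjugate p.toReal := by
  have hq0 : q ≠ 0 := by rintro rfl; simp at hpq
  have hp0 : p ≠ 0 := (zero_lt_one.trans_le hp1).ne'
  have h1 : p.toReal⁻¹ + q.toReal⁻¹ = 1 := by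
    have := congrArg ENNReal.toReal hpq
    rwa [ENNReal.toReal_add (ENNReal.inv_ne_top.2 hp0) (ENNReal.inv_ne_top.2 hq0),
      ENNReal.toReal_inv, ENNReal.toReal_inv, ENNReal.toReal_one] at this
  have hqpos : 0 < q.toReal := ENNReal.toReal_pos hq0 hq
  have hppos : 0 < p.toReal := ENNReal.toReal_pos hp0 hp'
  have hqi : 0 < q.toReal⁻¹ := by positivity
  have hpi : 0 < p.toReal⁻¹ := by positivity
  refine Real.holderConjugate_iff.2 ⟨?_, by linarith⟩
  rw [← inv_lt_one₀ hqpos]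
  linarith

/-- Hölder's inequality for the duality between test functions and weighted sequences. -/
theorem tsum_mul_le (hp : 1 ≤ p) (hp' : p ≠ ∞) (hpq : p⁻¹ + q⁻¹ = 1) (hh : 0 < h)
    (φ : ℝ → ℂ) (a : ℕ → ℝ≥0∞) :
    ∑' α, eLpNorm (iteratedDeriv α φ) q (intervalMeasure T) * a α ≤
      testNorm q s h T φ * wsum p s h a ^ (1 / p.toReal) := by
  set b : ℕ → ℝ≥0∞ := fun α => eLpNorm (iteratedDeriv α φ) q (intervalMeasure T) with hb
  have hfac : ∀ α : ℕ, (0 : ℝ) < Nat.factorial α := fun α => by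
    exact_mod_cast Nat.factorial_pos α
  -- The two weights are dual: the test norm carries `r α`, the weighted sum carries `(r α)⁻¹`, and
  -- they cancel in the product.
  set r : ℕ → ℝ := fun α => h ^ α / (Nat.factorial α : ℝ) ^ s with hr
  have hr0 : ∀ α, 0 < r α := fun α => by
    have := hfac α
    simp only [hr]; positivity
  have hrw : ∀ (x : ℝ) (α : ℕ), r α ^ x =
      h ^ (x * α) / (Nat.factorial α : ℝ) ^ (x * s) := by
    intro x α
    have := hfac α
    simp only [hr]
    rw [Real.div_rpow (by positivity) (by positivity), ← Real.rpow_natCast,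
      ← Real.rpow_mul hh.le, ← Real.rpow_mul this.le, mul_comm (α : ℝ), mul_comm s]
  have hweight : ∀ α, ENNReal.ofReal (weight p s h α) =
      ((ENNReal.ofReal (r α))⁻¹) ^ p.toReal := by
    intro α
    rw [← ENNReal.ofReal_inv_of_pos (hr0 α), ENNReal.ofReal_rpow_of_pos (inv_pos.2 (hr0 α)),
      Real.inv_rpow (hr0 α).le, hrw, inv_div, weight]
  have hsplit : ∀ α, b α * a α =
      (ENNReal.ofReal (r α) * b α) * ((ENNReal.ofReal (r α))⁻¹ * a α) := by
    intro α
    have h0 : ENNReal.ofReal (r α) ≠ 0 := by simpa using hr0 α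
    rw [mul_mul_mul_comm, ENNReal.mul_inv_cancel h0 ENNReal.ofReal_ne_top, one_mul]
  have hws : wsum p s h a = ∑' α, ((ENNReal.ofReal (r α))⁻¹ * a α) ^ p.toReal := by
    refine tsum_congr fun α => ?_
    rw [ENNReal.mul_rpow_of_nonneg _ _ ENNReal.toReal_nonneg, hweight]
  change ∑' α, b α * a α ≤ _
  rw [hws, tsum_congr hsplit]
  by_cases hq : q = ∞
  · have hp1 : p = 1 := by
      rw [hq, ENNReal.inv_top, add_zero, ENNReal.inv_eq_one] at hpq
      exact hpq
    subst hp1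
    simp only [ENNReal.toReal_one, ENNReal.rpow_one, div_one]
    rw [← ENNReal.tsum_mul_left]
    refine ENNReal.tsum_le_tsum fun α => ?_
    gcongr
    rw [testNorm, if_pos hq]
    refine le_iSup_of_le α ?_
    simp only [hb, hq]
    exact le_rfl
  · have hconj := holderConjugate_toReal hp' hp hq hpq
    have h1 := ENNReal.lintegral_mul_le_Lp_mul_Lq (Measure.count : Measure ℕ) hconj
      (f := fun α => ENNReal.ofReal (r α) * b α) (g := fun α => (ENNReal.ofReal (r α))⁻¹ * a α)
      (measurable_of_countable _).aemeasurable (measurable_of_countable _).aemeasurable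
    simp only [lintegral_count, Pi.mul_apply] at h1
    refine h1.trans_eq ?_
    rw [testNorm, if_neg hq]
    congr 2
    refine tsum_congr fun α => ?_
    rw [ENNReal.mul_rpow_of_nonneg _ _ ENNReal.toReal_nonneg,
      ENNReal.ofReal_rpow_of_pos (hr0 α), hrw]

theorem TestSpace.memLp_iteratedDeriv (hp : 1 ≤ p) (hp' : p ≠ ∞) (hpq : p⁻¹ + q⁻¹ = 1)
    (hh : 0 < h) {φ : ℝ → ℂ} (hφ : φ ∈ TestSpace q s h T) (α : ℕ) :
    MemLp (iteratedDeriv α φ) q (intervalMeasure T) := by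
  refine ⟨?_, ?_⟩
  · have h1 : ContinuousOn (iteratedDerivWithin α φ (Ioo 0 T)) (Ioo 0 T) :=
      hφ.1.continuousOn_iteratedDerivWithin (by exact_mod_cast le_top) isOpen_Ioo.uniqueDiffOn
    have h2 : ContinuousOn (iteratedDeriv α φ) (Ioo 0 T) :=
      h1.congr fun t ht => (iteratedDerivWithin_of_isOpen isOpen_Ioo ht).symm
    exact h2.aestronglyMeasurable measurableSet_Ioo
  -- Testing the inequality on a unit sequence isolates the norm of one derivative, for finite and
  -- infinite `q` alike.
  · have h1 := tsum_mul_le (s := s) (T := T) hp hp' hpq hh φ (Pi.single α 1)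
    have h2 : wsum p s h (Pi.single α 1) < ∞ := by
      refine wsum_lt_top_of_finite hp hp' (α + 1) (fun β => ?_) fun β hβ => ?_
      · by_cases hβ : β = α
        · subst hβ; simp
        · simp [hβ]
      · exact Pi.single_eq_of_ne (by omega) _
    have h3 := (ENNReal.le_tsum α).trans h1
    simp only [Pi.single_eq_same, mul_one] at h3
    exact h3.trans_lt (ENNReal.mul_lt_top hφ.2
      (ENNReal.rpow_lt_top_of_nonneg (by positivity) h2.ne))

variable {E : Type*} [NormedAddCommGroup E] [NormedSpace ℂ E]

theorem holderTriple_of_inv_add_inv (hpq : p⁻¹ + q⁻¹ = 1) : ENNReal.HolderTriple q p 1 :=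
  ⟨by rw [add_comm, hpq, inv_one]⟩

theorem integrable_iteratedDeriv_smul (hp : 1 ≤ p) (hp' : p ≠ ∞) (hpq : p⁻¹ + q⁻¹ = 1)
    (hh : 0 < h) {φ : ℝ → ℂ} (hφ : φ ∈ TestSpace q s h T) (α : ℕ) {F : ℝ → E}
    (hF : MemLp F p (intervalMeasure T)) :
    Integrable (fun t => iteratedDeriv α φ t • F t) (intervalMeasure T) := by
  have := holderTriple_of_inv_add_inv hpq
  exact memLp_one_iff_integrable.1
    (hF.smul (TestSpace.memLp_iteratedDeriv hp hp' hpq hh hφ α))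

theorem enorm_pairing_term_le (hp : 1 ≤ p) (hp' : p ≠ ∞) (hpq : p⁻¹ + q⁻¹ = 1)
    (hh : 0 < h) {φ : ℝ → ℂ} (hφ : φ ∈ TestSpace q s h T) (α : ℕ) {F : ℝ → E}
    (hF : MemLp F p (intervalMeasure T)) :
    ‖(-1 : ℂ) ^ α • ∫ t, iteratedDeriv α φ t • F t ∂intervalMeasure T‖ₑ ≤
      eLpNorm (iteratedDeriv α φ) q (intervalMeasure T) * eLpNorm F p (intervalMeasure T) := by
  have := holderTriple_of_inv_add_inv hpq
  have h1 : ‖(-1 : ℂ) ^ α‖ₑ = 1 := by simp [← ofReal_norm]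
  rw [enorm_smul, h1, one_mul]
  refine (enorm_integral_le_lintegral_enorm _).trans ?_
  rw [← eLpNorm_one_eq_lintegral_enorm]
  exact eLpNorm_smul_le_mul_eLpNorm hF.aestronglyMeasurable
    (TestSpace.memLp_iteratedDeriv hp hp' hpq hh hφ α).aestronglyMeasurable

theorem tsum_enorm_pairing_term_le (hp : 1 ≤ p) (hp' : p ≠ ∞) (hpq : p⁻¹ + q⁻¹ = 1)
    (hh : 0 < h) {φ : ℝ → ℂ} (hφ : φ ∈ TestSpace q s h T) {F : ℕ → ℝ → E}
    (hF : ∀ α, MemLp (F α) p (intervalMeasure T)) :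
    ∑' α : ℕ, ‖(-1 : ℂ) ^ α • ∫ t, iteratedDeriv α φ t • F α t ∂intervalMeasure T‖ₑ ≤
      testNorm q s h T φ * seqNorm p s h T F :=
  (ENNReal.tsum_le_tsum fun α => enorm_pairing_term_le hp hp' hpq hh hφ α (hF α)).trans
    (tsum_mul_le hp hp' hpq hh φ _)

variable [CompleteSpace E]

theorem hasSum_pairing (hp : 1 ≤ p) (hp' : p ≠ ∞) (hpq : p⁻¹ + q⁻¹ = 1)
    (hh : 0 < h) {φ : ℝ → ℂ} (hφ : φ ∈ TestSpace q s h T) {F : ℕ → ℝ → E}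
    (hF : ∀ α, MemLp (F α) p (intervalMeasure T)) (hFn : seqNorm p s h T F < ∞) :
    HasSum (fun α : ℕ => (-1 : ℂ) ^ α • ∫ t, iteratedDeriv α φ t • F α t ∂intervalMeasure T)
      (pairing T F φ) := by
  refine Summable.hasSum (Summable.of_enorm ?_)
  exact ((tsum_enorm_pairing_term_le hp hp' hpq hh hφ hF).trans_lt
    (ENNReal.mul_lt_top hφ.2 hFn)).ne

theorem enorm_pairing_le (hp : 1 ≤ p) (hp' : p ≠ ∞) (hpq : p⁻¹ + q⁻¹ = 1)
    (hh : 0 < h) {φ : ℝ → ℂ} (hφ : φ ∈ TestSpace q s h T) {F : ℕ → ℝ → E}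
    (hF : ∀ α, MemLp (F α) p (intervalMeasure T)) :
    ‖pairing T F φ‖ₑ ≤ testNorm q s h T φ * seqNorm p s h T F :=
  enorm_tsum_le_tsum_enorm.trans (tsum_enorm_pairing_term_le hp hp' hpq hh hφ hF)

theorem tendsto_norm_pairing (hp : 1 ≤ p) (hp' : p ≠ ∞) (hpq : p⁻¹ + q⁻¹ = 1)
    (hh : 0 < h) {φ : ℝ → ℂ} (hφ : φ ∈ TestSpace q s h T) {F : ℕ → ℕ → ℝ → E}
    (hF : ∀ k α, MemLp (F k α) p (intervalMeasure T))
    (hlim : Tendsto (fun k => seqNorm p s h T (F k)) atTop (𝓝 0)) :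
    Tendsto (fun k => ‖pairing T (F k) φ‖) atTop (𝓝 0) := by
  have h1 : Tendsto (fun k => testNorm q s h T φ * seqNorm p s h T (F k)) atTop (𝓝 0) := by
    simpa using ENNReal.Tendsto.const_mul hlim (.inr hφ.2.ne)
  have h2 : Tendsto (fun k => ‖pairing T (F k) φ‖ₑ) atTop (𝓝 0) :=
    tendsto_of_tendsto_of_tendsto_of_le_of_le tendsto_const_nhds h1 (fun _ => zero_le)
      fun k => enorm_pairing_le hp hp' hpq hh hφ (hF k)
  have h3 := (ENNReal.tendsto_toReal ENNReal.zero_ne_top).comp h2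
  simpa [Function.comp_def] using h3

end Pairing

/-! ### Solutions of the sequence-valued problem. -/

section Solutions

variable {E : Type*} [NormedAddCommGroup E] [NormedSpace ℂ E] {A : E →ₗ.[ℂ] E}
  {p q : ℝ≥0∞} {s h T ω C : ℝ}

/-- The resolvent as a bounded operator into the domain with the graph norm. -/
def IsResolventAt.toGraphDomain {z : ℂ} {R : E →L[ℂ] E} (hR : IsResolventAt A z R) :
    E →L[ℂ] GraphDomain A :=
  LinearMap.mkContinuous
    { toFun := fun x => (⟨R x, (hR.1 x).1⟩ : A.domain)
      map_add' := fun x y => Subtype.ext (map_add R x y)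
      map_smul' := fun c x => Subtype.ext (map_smul R c x) }
    (‖R‖ + (‖z‖ * ‖R‖ + 1)) (fun x => by
      rw [GraphDomain.norm_eq]
      have h1 : A ⟨R x, (hR.1 x).1⟩ = z • R x - x :=
        (sub_eq_of_eq_add (sub_eq_iff_eq_add'.1 (hR.1 x).2)).symm
      change ‖R x‖ + ‖A ⟨R x, (hR.1 x).1⟩‖ ≤ _
      rw [h1, add_mul, add_mul, one_mul, mul_assoc]
      refine add_le_add (R.le_opNorm x) ((norm_sub_le _ _).trans (add_le_add ?_ le_rfl))
      rw [norm_smul]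
      exact mul_le_mul_of_nonneg_left (R.le_opNorm x) (norm_nonneg z))

theorem IsResolventAt.toGraphDomain_apply {z : ℂ} {R : E →L[ℂ] E} (hR : IsResolventAt A z R)
    (x : E) : ((hR.toGraphDomain x).toDomain : E) = R x := rfl

theorem HilleYosida.exists_isResolventAt (hHY : HilleYosida A ω C) :
    ∃ (z : ℂ) (R : E →L[ℂ] E), IsResolventAt A z R := by
  obtain ⟨R, hR, -⟩ := hHY (ω + 1) (by linarith)
  exact ⟨_, R, hR⟩

/-- What needs proof is membership in `L^p(0, T; D(A))`, including measurability for the graph norm.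
Almost everywhere `u = R(z u - (u' - f))`, and `R` is bounded from `E` into `D(A)`. -/
theorem isStrictSolution_of_solvesAE (hHY : HilleYosida A ω C) (hp : 1 ≤ p) (hp' : p ≠ ∞)
    (hT : 0 < T) {f : ℕ → ℝ → E} {u₀ : ℕ → E} {u : ℕ → W1p E p T}
    (hf : ∀ α, MemLp (f α) p (intervalMeasure T))
    (hfw : wsum p s h (fun α => eLpNorm (f α) p (intervalMeasure T)) < ∞)
    (huw : wsum p s h (fun α => eLpNorm (u α) p (intervalMeasure T)) < ∞)
    (hduw : wsum p s h (fun α => eLpNorm (u α).der p (intervalMeasure T)) < ∞)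
    (hu : ∀ α, SolvesAE A (f α) (u α)) (h0 : ∀ α, (u α).init = u₀ α) :
    IsStrictSolution A p s h T f u₀ u := by
  refine ⟨⟨(seqSobolevNorm_lt_top_iff hp hp').2 ⟨huw, hduw⟩, ?_⟩,
    fun α => solvesAE_iff.1 (hu α), fun α => by rw [W1p.apply_zero, h0]⟩
  obtain ⟨z, R, hR⟩ := hHY.exists_isResolventAt
  set G := hR.toGraphDomain
  set g : ℕ → ℝ → E := fun α t => z • u α t - ((u α).der t - f α t) with hg
  have hzu : ∀ α, MemLp (fun t => z • u α t) p (intervalMeasure T) := fun α =>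
    ((u α).memLp hp hT.le).const_smul z
  have hdf : ∀ α, MemLp (fun t => (u α).der t - f α t) p (intervalMeasure T) := fun α =>
    (Lp.memLp (u α).der).sub (hf α)
  have hgm : ∀ α, MemLp (g α) p (intervalMeasure T) := fun α => (hzu α).sub (hdf α)
  have hGg : ∀ α, MemLp (fun t => G (g α t)) p (intervalMeasure T) := fun α =>
    G.comp_memLp' (hgm α)
  refine ⟨fun α => (hGg α).toLp _, ?_, fun α => ?_⟩
  · refine (seqNorm_lt_top_iff hp hp').2 ?_
    have hle : ∀ α, eLpNorm ((hGg α).toLp _) p (intervalMeasure T) ≤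
        ENNReal.ofReal ‖G‖ * (‖z‖ₑ * eLpNorm (u α) p (intervalMeasure T) +
          (eLpNorm (u α).der p (intervalMeasure T) + eLpNorm (f α) p (intervalMeasure T))) := by
      intro α
      rw [eLpNorm_congr_ae (hGg α).coeFn_toLp]
      refine (eLpNorm_le_mul_eLpNorm_of_ae_le_mul (.of_forall fun t => G.le_opNorm (g α t))
        p).trans ?_
      gcongr
      refine (eLpNorm_sub_le (hzu α).aestronglyMeasurable (hdf α).aestronglyMeasurable hp).trans
        (add_le_add ?_ (eLpNorm_sub_le (Lp.aestronglyMeasurable _) (hf α).aestronglyMeasurable hp))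
      exact eLpNorm_const_smul_le
    refine (wsum_mono hle).trans_lt ?_
    exact wsum_const_mul_lt_top ENNReal.ofReal_ne_top (wsum_add_lt_top hp hp'
      (wsum_const_mul_lt_top enorm_ne_top huw) (wsum_add_lt_top hp hp' hduw hfw))
  · filter_upwards [(hGg α).coeFn_toLp, hu α] with t h1 h2
    rw [h1, hR.toGraphDomain_apply]
    exact hR.apply_graph h2

variable [CompleteSpace E]

/-- In the form `R(z u - (u' - f)) = u` the equation involves bounded operators only, so it passes
through the integral against `φ^{(α)}` and the absolutely convergent series. -/
theorem IsStrictSolution.isStrictWeakSolution (hHY : HilleYosida A ω C) (hp : 1 ≤ p)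
    (hp' : p ≠ ∞) (hpq : p⁻¹ + q⁻¹ = 1) (hh : 0 < h) (hT : 0 < T) {f : ℕ → ℝ → E} {u₀ : ℕ → E}
    {u : ℕ → W1p E p T} (hf : ∀ α, MemLp (f α) p (intervalMeasure T))
    (hfn : seqNorm p s h T f < ∞) (hu : IsStrictSolution A p s h T f u₀ u) :
    IsStrictWeakSolution A p q s h T f u₀ u := by
  refine ⟨hu.1, fun φ hφ => ?_, hu.2.2⟩
  obtain ⟨z, R, hR⟩ := hHY.exists_isResolventAt
  obtain ⟨huw, hduw⟩ := (seqSobolevNorm_lt_top_iff hp hp').1 hu.1.1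
  have hum : ∀ α, MemLp (u α) p (intervalMeasure T) := fun α => (u α).memLp hp hT.le
  have hdm : ∀ α, MemLp (u α).der p (intervalMeasure T) := fun α => Lp.memLp _
  have hs1 := hasSum_pairing hp hp' hpq hh hφ hum ((seqNorm_lt_top_iff hp hp').2 huw)
  have hs2 := hasSum_pairing hp hp' hpq hh hφ hdm ((seqNorm_lt_top_iff hp hp').2 hduw)
  have hs3 := hasSum_pairing hp hp' hpq hh hφ hf hfn
  refine mem_graph_sub_iff.1 (hR.mem_graph_iff.2 ?_)
  refine (R.hasSum ((hs1.const_smul z).sub (hs2.sub hs3))).unique ?_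
  refine hs1.congr_fun fun α => ?_
  have hi1 := integrable_iteratedDeriv_smul hp hp' hpq hh hφ α (hum α)
  have hi2 := integrable_iteratedDeriv_smul hp hp' hpq hh hφ α (hdm α)
  have hi3 := integrable_iteratedDeriv_smul hp hp' hpq hh hφ α (hf α)
  have hint : ∫ t, iteratedDeriv α φ t • u α t ∂intervalMeasure T =
      R (z • (∫ t, iteratedDeriv α φ t • u α t ∂intervalMeasure T) -
        ((∫ t, iteratedDeriv α φ t • (u α).der t ∂intervalMeasure T) -
          ∫ t, iteratedDeriv α φ t • f α t ∂intervalMeasure T)) := by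
    have hi4 : Integrable (fun t => z • iteratedDeriv α φ t • u α t) (intervalMeasure T) :=
      hi1.smul z
    have hi5 : Integrable (fun t => iteratedDeriv α φ t • (u α).der t - iteratedDeriv α φ t • f α t)
        (intervalMeasure T) := hi2.sub hi3
    have hi6 : Integrable (fun t => z • iteratedDeriv α φ t • u α t -
        (iteratedDeriv α φ t • (u α).der t - iteratedDeriv α φ t • f α t)) (intervalMeasure T) :=
      hi4.sub hi5
    rw [← integral_smul, ← integral_sub hi2 hi3, ← integral_sub hi4 hi5,
      ← R.integral_comp_comm hi6]
    refine integral_congr_ae ?_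
    filter_upwards [solvesAE_iff.2 (hu.2.1 α)] with t ht
    rw [smul_comm z, ← smul_sub, ← smul_sub, map_smul, hR.apply_graph ht]
  rw [smul_comm z, ← smul_sub, ← smul_sub, map_smul, ← hint]

theorem IsFSolution.isFWeakSolution (hHY : HilleYosida A ω C) (hp : 1 ≤ p)
    (hp' : p ≠ ∞) (hpq : p⁻¹ + q⁻¹ = 1) (hh : 0 < h) (hT : 0 < T) {f : ℕ → LpI E p T}
    {u₀ : ℕ → E} {u : ℕ → LpI E p T} (hu : IsFSolution A p s h T (fun α => f α) u₀ u) :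
    IsFWeakSolution A p q s h T (fun α => f α) u₀ u := by
  obtain ⟨h1, uk, fk, u₀k, hk, hlim⟩ := hu
  refine ⟨h1, uk, fk, u₀k, fun k => ⟨(hk k).1, (hk k).2.isStrictWeakSolution hHY hp hp' hpq hh hT
    (fun α => Lp.memLp _) (hk k).1⟩, fun φ hφ => ?_⟩
  have l1 := tendsto_norm_pairing hp hp' hpq hh hφ (F := fun k α t => uk k α t - u α t)
    (fun k α => ((uk k α).memLp hp hT.le).sub (Lp.memLp (u α)))
    (tendsto_of_tendsto_of_tendsto_of_le_of_le tendsto_const_nhds hlim (fun _ => zero_le)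
      fun k => le_self_add.trans le_self_add)
  have l2 := tendsto_norm_pairing hp hp' hpq hh hφ (F := fun k α t => fk k α t - f α t)
    (fun k α => (Lp.memLp (fk k α)).sub (Lp.memLp (f α)))
    (tendsto_of_tendsto_of_tendsto_of_le_of_le tendsto_const_nhds hlim (fun _ => zero_le)
      fun k => le_add_self.trans le_self_add)
  have l3 := tendsto_norm_pairing hp hp' hpq hh hφ
    (fun k α => memLp_const (μ := intervalMeasure T) (u₀k k α - u₀ α))
    (tendsto_of_tendsto_of_tendsto_of_le_of_le tendsto_const_nhds hlim (fun _ => zero_le)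
      fun k => le_add_self)
  have l := (l1.add l2).add l3
  rwa [add_zero, add_zero] at l

theorem IsFSolution.tendsto_components (hp : 1 ≤ p) (hp' : p ≠ ∞) (hh : 0 < h) (hT : 0 < T)
    {f : ℕ → ℝ → E} {u₀ : ℕ → E} {u : ℕ → LpI E p T} (hu : IsFSolution A p s h T f u₀ u)
    (α : ℕ) : ∃ (w : ℕ → W1p E p T) (k : ℕ → LpI E p T), (∀ n, SolvesAE A (k n) (w n)) ∧
      Tendsto (fun n => eLpNorm (fun t => w n t - u α t) p (intervalMeasure T)) atTop (𝓝 0) ∧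
      Tendsto (fun n => eLpNorm (fun t => k n t - f α t) p (intervalMeasure T)) atTop (𝓝 0) ∧
      Tendsto (fun n => ‖(w n).init - u₀ α‖ₑ) atTop (𝓝 0) := by
  obtain ⟨-, uk, fk, u₀k, hk, hlim⟩ := hu
  refine ⟨fun n => uk n α, fun n => fk n α, fun n => solvesAE_iff.2 ((hk n).2.2.1 α), ?_, ?_, ?_⟩
  · exact tendsto_of_tendsto_wsum hp hp' hh ((tendsto_seqNorm_iff hp hp').1
      (tendsto_of_tendsto_of_tendsto_of_le_of_le tendsto_const_nhds hlim (fun _ => zero_le)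
        fun k => le_self_add.trans le_self_add)) α
  · exact tendsto_of_tendsto_wsum hp hp' hh ((tendsto_seqNorm_iff hp hp').1
      (tendsto_of_tendsto_of_tendsto_of_le_of_le tendsto_const_nhds hlim (fun _ => zero_le)
        fun k => le_add_self.trans le_self_add)) α
  · have h1 := tendsto_of_tendsto_wsum hp hp' hh ((tendsto_seqNorm_iff hp hp').1
      (tendsto_of_tendsto_of_tendsto_of_le_of_le tendsto_const_nhds hlim (fun _ => zero_le)
        fun k => le_add_self)) α
    have hκ0 : intervalMeasure T univ ^ p.toReal⁻¹ ≠ 0 := rpow_intervalMeasure_univ_ne_zero hT _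
    -- A constant function has norm `T^{1/p}` times that of its value; dividing recovers convergence
    -- of the initial values.
    have h2 := ENNReal.Tendsto.mul_const h1 (.inr (ENNReal.inv_ne_top.2 hκ0))
    rw [zero_mul] at h2
    refine h2.congr fun n => ?_
    rw [eLpNorm_const_interval hp hT, mul_assoc,
      ENNReal.mul_inv_cancel hκ0 (rpow_intervalMeasure_univ_ne_top p T), mul_one,
      ← (hk n).2.2.2 α, W1p.apply_zero]

/-- In each component, the stability estimate compares the strict approximants of the two solutions,
whose data have the same limits. -/
theorem IsFSolution.unique (hHY : HilleYosida A ω C) (hp : 1 ≤ p)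
    (hp' : p ≠ ∞) (hh : 0 < h) (hT : 0 < T) {f : ℕ → LpI E p T}
    {u₀ : ℕ → E} {u v : ℕ → LpI E p T} (hu : IsFSolution A p s h T (fun α => f α) u₀ u)
    (hv : IsFSolution A p s h T (fun α => f α) u₀ v) : v = u := by
  funext α
  obtain ⟨K, hK, hest⟩ := eLpNorm_sub_le_of_solvesAE (p := p) hHY hp hT
  obtain ⟨w, k, hwk, hw, hk, hw0⟩ := hu.tendsto_components hp hp' hh hT α
  obtain ⟨w', k', hwk', hw', hk', hw0'⟩ := hv.tendsto_components hp hp' hh hT α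
  have hle : ∀ n, eLpNorm (fun t => v α t - u α t) p (intervalMeasure T) ≤
      eLpNorm (fun t => w n t - u α t) p (intervalMeasure T) +
        eLpNorm (fun t => w' n t - v α t) p (intervalMeasure T) +
        K * ((‖(w' n).init - u₀ α‖ₑ + ‖(w n).init - u₀ α‖ₑ) +
          (eLpNorm (fun t => k' n t - f α t) p (intervalMeasure T) +
            eLpNorm (fun t => k n t - f α t) p (intervalMeasure T))) := by
    intro n
    have m1 := ((w n).memLp hp hT.le).sub (Lp.memLp (u α))
    have m2 := ((w' n).memLp hp hT.le).sub (Lp.memLp (v α))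
    have m3 := ((w' n).memLp hp hT.le).sub ((w n).memLp hp hT.le)
    have m4 := (Lp.memLp (k' n)).sub (Lp.memLp (f α))
    have m5 := (Lp.memLp (k n)).sub (Lp.memLp (f α))
    have e1 : (fun t => v α t - u α t) = ((fun t => w n t - u α t) - fun t => w' n t - v α t) +
        fun t => w' n t - w n t := by
      funext t; simp only [Pi.add_apply, Pi.sub_apply]; abel
    have e2 : (fun t => k' n t - k n t) =
        (fun t => k' n t - f α t) - fun t => k n t - f α t := by funext t; simp
    have e3 : (w' n).init - (w n).init = ((w' n).init - u₀ α) - ((w n).init - u₀ α) := by abel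
    rw [e1]
    refine (eLpNorm_add_le (m1.sub m2).aestronglyMeasurable m3.aestronglyMeasurable hp).trans
      (add_le_add (eLpNorm_sub_le m1.aestronglyMeasurable m2.aestronglyMeasurable hp) ?_)
    refine (hest _ _ _ _ (Lp.memLp _) (Lp.memLp _) (hwk' n) (hwk n)).trans ?_
    gcongr
    · rw [e3]; exact enorm_sub_le
    · rw [e2]; exact eLpNorm_sub_le m4.aestronglyMeasurable m5.aestronglyMeasurable hp
  have hlim := (hw.add hw').add
    (ENNReal.Tendsto.const_mul (a := K) ((hw0'.add hw0).add (hk'.add hk)) (.inr hK))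
  simp only [add_zero, mul_zero] at hlim
  have h0 : eLpNorm (v α - u α : ℝ → E) p (intervalMeasure T) ≤ 0 :=
    ge_of_tendsto hlim (.of_forall hle)
  have h1 := (eLpNorm_eq_zero_iff ((Lp.memLp (v α)).sub (Lp.memLp (u α))).aestronglyMeasurable
    (zero_lt_one.trans_le hp).ne').1 (le_antisymm h0 zero_le)
  refine Lp.ext ?_
  filter_upwards [h1] with t ht
  exact sub_eq_zero.1 ht

theorem exists_isFSolution (hA : A.IsClosed) (hHY : HilleYosida A ω C) (hp : 1 ≤ p)
    (hp' : p ≠ ∞) (hh : 0 < h) (hT : 0 < T) {f : ℕ → LpI E p T} {u₀ : ℕ → E}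
    (hf : f ∈ SeqLp E p s h T) (hu₀ : WeightedSummable p s h u₀)
    (hcl : ∀ α, u₀ α ∈ closure (A.domain : Set E)) :
    ∃ u : ℕ → LpI E p T, IsFSolution A p s h T (fun α => f α) u₀ u := by
  choose U hU using fun α => exists_limit_solution (T := T) hA hHY hp hp' hT (Lp.memLp (f α)) (hcl α)
  obtain ⟨K, hK, hest⟩ := IsLimitSolution.eLpNorm_le (p := p) hHY hp hT
  have hfw : wsum p s h (fun α => eLpNorm (f α) p (intervalMeasure T)) < ∞ :=
    (seqNorm_lt_top_iff hp hp').1 hf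
  have hUw : wsum p s h (fun α => eLpNorm (U α) p (intervalMeasure T)) < ∞ :=
    (wsum_mono fun α => hest _ _ _ (Lp.memLp (f α)) (hU α)).trans_lt
      (wsum_const_mul_lt_top hK (wsum_add_lt_top hp hp' (hu₀.wsum_lt_top hh) hfw))
  set κ := intervalMeasure T univ ^ p.toReal⁻¹ with hκ
  have hκt : κ ≠ ∞ := rpow_intervalMeasure_univ_ne_top p T
  -- Initial errors are measured as constant functions and gain the factor `κ = T^{1/p}`; the
  -- divisor makes both `δ` and `δ * κ` admissible.
  set δ : ℕ → ℝ≥0∞ := fun k => truncTol p s h k / (1 + κ) with hδ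
  have hδ0 : ∀ k, δ k ≠ 0 := fun k =>
    (ENNReal.div_pos (truncTol_ne_zero p s h k) (by simp [hκt])).ne'
  have hδ1 : ∀ k, δ k ≤ truncTol p s h k := fun k =>
    ENNReal.div_le_of_le_mul (le_mul_of_one_le_right zero_le le_self_add)
  have hδκ : ∀ k, δ k * κ ≤ truncTol p s h k := fun k =>
    (mul_le_mul_right (le_add_self : κ ≤ 1 + κ) _).trans
      (ENNReal.div_mul_cancel (by simp) (by simp [hκt])).le
  choose w g hwg hinit hdata hlim using fun k α => hU α (δ k) (hδ0 k)
  -- Only finitely many components are nonzero, so all norms are finite although nothing bounds the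
  -- derivatives of the `w k α` uniformly in `α`.
  set uk : ℕ → ℕ → W1p E p T := fun k α => if α < k then w k α else ⟨0, 0⟩ with huk
  set fk : ℕ → ℕ → LpI E p T := fun k α =>
    if α < k then ((g k α).memLp hp hT.le).toLp (g k α) else 0 with hfk
  have uk1 : ∀ {k α}, α < k → uk k α = w k α := fun hα => if_pos hα
  have uk2 : ∀ {k α}, k ≤ α → uk k α = ⟨0, 0⟩ := fun hα => if_neg (not_lt.2 hα)
  have fk1 : ∀ {k α}, α < k → fk k α = ((g k α).memLp hp hT.le).toLp (g k α) := fun hα => if_pos hα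
  have fk2 : ∀ {k α}, k ≤ α → fk k α = 0 := fun hα => if_neg (not_lt.2 hα)
  have z1 : eLpNorm (⟨0, 0⟩ : W1p E p T) p (intervalMeasure T) = 0 := by
    rw [eLpNorm_congr_ae (ae_intervalMeasure_of_forall_Icc fun t ht => W1p.zero_apply ht)]
    exact eLpNorm_zero
  have z2 : eLpNorm (0 : LpI E p T) p (intervalMeasure T) = 0 := by
    rw [eLpNorm_congr_ae (Lp.coeFn_zero E p _)]
    exact eLpNorm_zero
  have hsolve : ∀ k α, SolvesAE A (fk k α) (uk k α) := by
    intro k α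
    rcases lt_or_ge α k with hα | hα
    · rw [uk1 hα, fk1 hα]
      exact (hwg k α).congr ((g k α).memLp hp hT.le).coeFn_toLp.symm
    · rw [uk2 hα, fk2 hα]
      exact solvesAE_zero A
  have hfkw : ∀ k, wsum p s h (fun α => eLpNorm (fk k α) p (intervalMeasure T)) < ∞ := fun k =>
    wsum_lt_top_of_finite hp hp' k (fun α => (Lp.memLp _).eLpNorm_ne_top)
      fun α hα => by rw [fk2 hα, z2]
  have hukw : ∀ k, wsum p s h (fun α => eLpNorm (uk k α) p (intervalMeasure T)) < ∞ := fun k =>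
    wsum_lt_top_of_finite hp hp' k (fun α => ((uk k α).memLp hp hT.le).eLpNorm_ne_top)
      fun α hα => by rw [uk2 hα, z1]
  have hdkw : ∀ k, wsum p s h (fun α => eLpNorm (uk k α).der p (intervalMeasure T)) < ∞ :=
    fun k => wsum_lt_top_of_finite hp hp' k (fun α => (Lp.memLp _).eLpNorm_ne_top)
      fun α hα => by rw [uk2 hα, z2]
  refine ⟨U, (seqNorm_lt_top_iff hp hp').2 hUw, uk, fk, fun k α => (uk k α).init, fun k =>
    ⟨(seqNorm_lt_top_iff hp hp').2 (hfkw k), isStrictSolution_of_solvesAE hHY hp hp' hT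
      (fun α => Lp.memLp _) (hfkw k) (hukw k) (hdkw k) (hsolve k) fun α => rfl⟩, ?_⟩
  have l1 : Tendsto (fun k => seqNorm p s h T (fun α t => uk k α t - U α t)) atTop (𝓝 0) := by
    refine (tendsto_seqNorm_iff hp hp').2 (tendsto_wsum_trunc hp hp' hUw (fun k α hα => ?_)
      fun k α hα => ?_)
    · rw [uk1 hα]
      exact (hlim k α).trans (hδ1 k)
    · rw [uk2 hα, ← eLpNorm_neg (f := (U α : ℝ → E))]
      exact (eLpNorm_congr_ae (ae_intervalMeasure_of_forall_Icc fun t ht => by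
        rw [W1p.zero_apply ht, zero_sub, Pi.neg_apply])).le
  have l2 : Tendsto (fun k => seqNorm p s h T (fun α t => fk k α t - f α t)) atTop (𝓝 0) := by
    refine (tendsto_seqNorm_iff hp hp').2 (tendsto_wsum_trunc hp hp' hfw (fun k α hα => ?_)
      fun k α hα => ?_)
    · rw [fk1 hα]
      refine le_trans (le_of_eq (eLpNorm_congr_ae ?_)) ((hdata k α).trans (hδ1 k))
      filter_upwards [((g k α).memLp hp hT.le).coeFn_toLp] with t ht
      rw [ht]
    · rw [fk2 hα, ← eLpNorm_neg (f := (f α : ℝ → E))]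
      refine (eLpNorm_congr_ae ?_).le
      filter_upwards [Lp.coeFn_zero E p (intervalMeasure T)] with t ht
      rw [ht, Pi.zero_apply, zero_sub, Pi.neg_apply]
  have l3 : Tendsto (fun k => seqNorm p s h T (fun α _ => (uk k α).init - u₀ α)) atTop
      (𝓝 0) := by
    have hu₀w := wsum_const_mul_lt_top hκt (hu₀.wsum_lt_top hh)
    refine (tendsto_seqNorm_iff hp hp').2 (tendsto_wsum_trunc hp hp' hu₀w (fun k α hα => ?_)
      fun k α hα => ?_)
    · rw [uk1 hα, eLpNorm_const_interval hp hT]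
      exact (mul_le_mul_left (hinit k α) _).trans (hδκ k)
    · rw [uk2 hα, eLpNorm_const_interval hp hT, zero_sub, enorm_neg, mul_comm]
  simpa using (l1.add l2).add l3

/-- No approximation in `α` is needed: the bounds on solution and derivative hold with one constant
for all components and are summed. -/
theorem exists_isStrictSolution (hA : A.IsClosed) (hHY : HilleYosida A ω C) (hp : 1 ≤ p)
    (hp' : p ≠ ∞) (hh : 0 < h) (hT : 0 < T) {f : ℕ → W1p E p T} {u₀ : ℕ → A.domain}
    (hf : f ∈ SeqW1p E p s h T) (hcl : ∀ α, A (u₀ α) + f α 0 ∈ closure (A.domain : Set E))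
    (hu₀ : WeightedSummable p s h (fun α => (u₀ α : E)))
    (ha₀ : WeightedSummable p s h (fun α => A (u₀ α))) :
    ∃ u : ℕ → W1p E p T,
      IsStrictSolution A p s h T (fun α => f α) (fun α => (u₀ α : E)) u := by
  obtain ⟨K, hK, hex⟩ := exists_solvesAE (p := p) hA hHY hp hT
  obtain ⟨hfw, hdfw⟩ := (seqSobolevNorm_lt_top_iff hp hp').1 hf
  choose u hinit hsolve hder hnorm using fun α =>
    hex (f α) (u₀ α) (A (u₀ α)) (A.mem_graph (u₀ α)) (hcl α)
  have hc := wsum_add_lt_top hp hp' (ha₀.wsum_lt_top hh) (wsum_add_lt_top hp hp' hfw hdfw)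
  exact ⟨u, isStrictSolution_of_solvesAE hHY hp hp' hT (fun α => (f α).memLp hp hT.le) hfw
    ((wsum_mono hnorm).trans_lt (wsum_const_mul_lt_top hK
      (wsum_add_lt_top hp hp' (hu₀.wsum_lt_top hh) hc)))
    ((wsum_mono hder).trans_lt (wsum_const_mul_lt_top hK hc)) hsolve hinit⟩

theorem IsStrictSolution.unique (hHY : HilleYosida A ω C) (hp : 1 ≤ p) (hT : 0 < T)
    {f : ℕ → ℝ → E} (hf : ∀ α, MemLp (f α) p (intervalMeasure T)) {u₀ : ℕ → E}
    {u v : ℕ → W1p E p T} (hu : IsStrictSolution A p s h T f u₀ u)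
    (hv : IsStrictSolution A p s h T f u₀ v) : v = u := by
  funext α
  obtain ⟨K, -, hest⟩ := enorm_sub_le_of_solvesAE (p := p) hHY hp hT
  refine W1p.ext_of_eqOn hp hT fun t ht => ?_
  have h1 := hest _ _ _ _ (hf α) (hf α) (solvesAE_iff.2 (hv.2.1 α)) (solvesAE_iff.2 (hu.2.1 α)) t ht
  have h2 : (v α).init = (u α).init := by
    rw [← W1p.apply_zero, ← W1p.apply_zero, hv.2.2, hu.2.2]
  rw [h2] at h1
  simp only [sub_self, enorm_zero, eLpNorm_zero', zero_add, mul_zero, nonpos_iff_eq_zero,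
    enorm_eq_zero] at h1
  exact sub_eq_zero.1 h1

end Solutions

end UltraCauchy

end

theorem mainTheorem3 {E : Type*} [NormedAddCommGroup E] [NormedSpace ℂ E] [CompleteSpace E]
    (A : E →ₗ.[ℂ] E) (hA : A.IsClosed) (ω C : ℝ) (hHY : UltraCauchy.HilleYosida A ω C)
    (p q : ℝ≥0∞) (hp : 1 ≤ p) (hp' : p ≠ ∞) (hpq : p⁻¹ + q⁻¹ = 1)
    (s h T : ℝ) (hs : 1 < s) (hh : 0 < h) (hT : 0 < T) :
    (∀ (f : ℕ → UltraCauchy.LpI E p T) (u₀ : ℕ → E),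
      f ∈ UltraCauchy.SeqLp E p s h T →
      UltraCauchy.WeightedSummable p s h u₀ →
      (∀ α, u₀ α ∈ closure (A.domain : Set E)) →
      ∃ u : ℕ → UltraCauchy.LpI E p T,
        UltraCauchy.IsFSolution A p s h T (fun α => f α) u₀ u ∧
        UltraCauchy.IsFWeakSolution A p q s h T (fun α => f α) u₀ u ∧
        ∀ v : ℕ → UltraCauchy.LpI E p T,
          UltraCauchy.IsFSolution A p s h T (fun α => f α) u₀ v → v = u) ∧
    (∀ (f : ℕ → UltraCauchy.W1p E p T) (u₀ : ℕ → A.domain),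
      f ∈ UltraCauchy.SeqW1p E p s h T →
      (∀ α, A (u₀ α) + f α 0 ∈ closure (A.domain : Set E)) →
      UltraCauchy.WeightedSummable p s h (fun α => (u₀ α : E)) →
      UltraCauchy.WeightedSummable p s h (fun α => A (u₀ α)) →
      ∃ u : ℕ → UltraCauchy.W1p E p T,
        UltraCauchy.IsStrictSolution A p s h T (fun α => f α) (fun α => (u₀ α : E)) u ∧
        UltraCauchy.IsStrictWeakSolution A p q s h T (fun α => f α) (fun α => (u₀ α : E)) u ∧
        ∀ v : ℕ → UltraCauchy.W1p E p T,
          UltraCauchy.IsStrictSolution A p s h T (fun α => f α) (fun α => (u₀ α : E)) v →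
            v = u) := by
  refine ⟨fun f u₀ hf hu₀ hcl => ?_, fun f u₀ hf hcl hu₀ ha₀ => ?_⟩
  · obtain ⟨u, hu⟩ := UltraCauchy.exists_isFSolution hA hHY hp hp' hh hT hf hu₀ hcl
    exact ⟨u, hu, hu.isFWeakSolution hHY hp hp' hpq hh hT,
      fun v hv => hu.unique hHY hp hp' hh hT hv⟩
  · obtain ⟨u, hu⟩ := UltraCauchy.exists_isStrictSolution hA hHY hp hp' hh hT hf hcl hu₀ ha₀
    have hfm := fun α => (f α).memLp hp hT.le
    exact ⟨u, hu, hu.isStrictWeakSolution hHY hp hp' hpq hh hT hfm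
      ((UltraCauchy.seqNorm_lt_top_iff hp hp').2
        ((UltraCauchy.seqSobolevNorm_lt_top_iff hp hp').1 hf).1),
      fun v hv => hu.unique hHY hp hT hfm hv⟩
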